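/- Let $k\in\frac12\mathbb Z$, $\Gamma=\mathrm{SL}_2(\mathbb Z)$, $S=\left(\begin{smallmatrix}0&-1\\1&0\end{smallmatrix}\right)$, $T=\left(\begin{smallmatrix}1&1\\0&1\end{smallmatrix}\right)$; complex powers are principal values. Let $\chi:\Gamma\to\mathbb C$ be a unitary multiplier system of weight $k$, i.e. $|\chi(\gamma)|=1$ and $\chi(\gamma_1\gamma_2)\,j(\gamma_1\gamma_2,\tau)^k=\chi(\gamma_1)\chi(\gamma_2)\,j(\gamma_1,\gamma_2\tau)^k j(\gamma_2,\tau)^k$ for all $\gamma_1,\gamma_2\in\Gamma$ and $\tau\in\mathbb H$, where $j\left(\left(\begin{smallmatrix}a&b\\c&d\end{smallmatrix}\right),\tau\right)=c\tau+d$. Let $\rho:\Gamma\to \mathrm{GL}(m,\mathbb C)$ be a unitary representation, and let $\kappa_j\in[0,1)$ $(1\le j\le m)$ satisfy $\chi(T)\rho(T)\mathbf e_j=e^{2\pi i\kappa_j}\mathbf e_j$. Write $\tau=u+iv\in\mathbb H$ and $\Gamma(a,w)=\int_w^\infty e^{-t}t^{a-1}\,dt$ for $w>0$. The space $H_{k,\chi,\rho}$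 of vector-valued harmonic weak Maass forms consists of the real-analytic $f:\mathbb H\to\mathbb C^m$ such that (1) $(c\tau+d)^{-k}\chi(\gamma)^{-1}\rho(\gamma)^{-1}f(\gamma\tau)=f(\tau)$ for all $\gamma=\left(\begin{smallmatrix}a&b\\c&d\end{smallmatrix}\right)\in\Gamma$; (2) $\Delta_kf=0$, where $\Delta_k=-4v^2\frac{\partial}{\partial\tau}\frac{\partial}{\partial\bar\tau}+2kiv\frac{\partial}{\partial\bar\tau}$; (3) for some $n_0\in\mathbb N$ and some coefficients $c^\pm_{f,j}(n)\in\mathbb C$, $f$ has an absolutely convergent expansion $$f(\tau)=\sum_{j=1}^m\sum_{n\ge -n_0}c^+_{f,j}(n)e^{2\pi i(n+\kappa_j)\tau}\mathbf e_j+\sum_{j=1}^m\sum_{n+\kappa_j<0}c^-_{f,j}(n)\,\Gamma(1-k,-4\pi(n+\kappa_j)v)\,e^{2\pi i(n+\kappa_j)\tau}\mathbf e_j.\qquad(*)$$ For a function $\varphi$ on $\mathbb R_+=(0,\infty)$ put $(\mathcal L\varphi)(s)=\int_0^\infty e^{-st}\varphi(t)\,dt$, $\varphi_s(x)=\varphi(x)x^{s-1}$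 and $(\varphi|_{2-k,\chi^{-1}}S)(x)=x^{k-2}\chi(S)\varphi(1/x)$. Let $S_c(\mathbb R_+)$ be a set of complex-valued, compactly supported, piecewise smooth functions on $\mathbb R_+$ (the value at a break point being one of the two one-sided limits) such that for every $y>0$ some $\varphi\in S_c(\mathbb R_+)$ has $\varphi(y)\ne0$, and such that $\varphi_s\in S_c(\mathbb R_+)$ whenever $\varphi\in S_c(\mathbb R_+)$ and $s\in\mathbb C$; for instance, the set of all such functions. **Theorem.** Let $n_0\in\mathbb N$. For each $1\le j\le m$ let $(c^+_{f,j}(n))_{n\ge -n_0}$ and $(c^-_{f,j}(n))_{n+\kappa_j<0}$ be sequences of complex numbers with $c^\pm_{f,j}(n)=O(e^{C\sqrt{|n|}})$ as $|n|\to\infty$, for some $C>0$, and let $f$ be the function on $\mathbb H$ given by $(*)$. For a compactly supported, piecewise smooth function $\varphi$ on $\mathbb R_+$ set $$L_f(\varphi)=\sum_{j=1}^m\Big(\sum_{n\ge -n_0}c^+_{f,j}(n)(\mathcal L\varphi)(2\pi(n+\kappa_j))+\sum_{n+\kappa_j<0}c^-_{f,j}(n)(-4\pi(n+\kappa_j))^{1-k}\int_0^\infty\frac{(\mathcal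 L\varphi_{2-k})(-2\pi(n+\kappa_j)(2t+1))}{(1+t)^k}dt\Big)\mathbf e_j$$ and, for $\delta_kf=\tau\frac{\partial f}{\partial u}+\frac k2f$, $$L_{\delta_kf}(\varphi)=\tfrac k2L_f(\varphi)-2\pi\sum_{j=1}^m\Big(\sum_{n\ge -n_0}c^+_{f,j}(n)(n+\kappa_j)(\mathcal L\varphi_2)(2\pi(n+\kappa_j))+\sum_{n+\kappa_j<0}c^-_{f,j}(n)(n+\kappa_j)(-4\pi(n+\kappa_j))^{1-k}\int_0^\infty\frac{(\mathcal L\varphi_{3-k})(-2\pi(n+\kappa_j)(2t+1))}{(1+t)^k}dt\Big)\mathbf e_j.$$ Suppose that for every $\varphi\in S_c(\mathbb R_+)$ $$L_f(\varphi)=i^k\rho(S)L_f(\varphi|_{2-k,\chi^{-1}}S)\quad\text{and}\quad L_{\delta_kf}(\varphi)=-i^k\rho(S)L_{\delta_kf}(\varphi|_{2-k,\chi^{-1}}S).$$ Then $f\in H_{k,\chi,\rho}$. -/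

import Mathlib

open scoped ContDiff Topology MatrixGroups UpperHalfPlane

noncomputable section

namespace VVMaass

/-! ### Multiplier systems and the slash operator

All complex powers are principal values, `z ^ s = exp (s * log z)` with `-π < arg z ≤ π`. -/

/-- The factor `(c τ + d) ^ k`. -/
def autFactor (k : ℝ) (γ : SL(2, ℤ)) (τ : ℍ) : ℂ :=
  (((γ 1 0 : ℤ) : ℂ) * (τ : ℂ) + ((γ 1 1 : ℤ) : ℂ)) ^ (k : ℂ)

/-- `χ` is a unitary multiplier system of weight `k` on `SL(2, ℤ)`. -/
structure IsMultiplierSystem (k : ℝ) (χ : SL(2, ℤ) → ℂ) : Prop where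
  norm_eq_one : ∀ γ, ‖χ γ‖ = 1
  consistency : ∀ (γ₁ γ₂ : SL(2, ℤ)) (τ : ℍ),
    χ (γ₁ * γ₂) * autFactor k (γ₁ * γ₂) τ =
      χ γ₁ * χ γ₂ * autFactor k γ₁ (γ₂ • τ) * autFactor k γ₂ τ

/-- The slash operator
`(f |_{k,χ,ρ} γ)(τ) = (c τ + d) ^ (-k) χ(γ)⁻¹ ρ(γ)⁻¹ f (γ τ)`. -/
def slash {m : ℕ} (k : ℝ) (χ : SL(2, ℤ) → ℂ) (ρ : SL(2, ℤ) →* Matrix.unitaryGroup (Fin m) ℂ)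
    (f : ℍ → Fin m → ℂ) (γ : SL(2, ℤ)) (τ : ℍ) : Fin m → ℂ :=
  (autFactor (-k) γ τ * (χ γ)⁻¹) •
    Matrix.mulVec ((ρ γ)⁻¹ : Matrix.unitaryGroup (Fin m) ℂ).1 (f (γ • τ))

/-! ### The hyperbolic Laplacian -/

/-- `∂/∂τ = (∂/∂u - i ∂/∂v) / 2` for `τ = u + i v`. -/
def dTau {m : ℕ} (F : ℂ → Fin m → ℂ) (z : ℂ) : Fin m → ℂ :=
  (1 / 2 : ℂ) • (fderiv ℝ F z 1 - Complex.I • fderiv ℝ F z Complex.I)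

/-- `∂/∂τ̄ = (∂/∂u + i ∂/∂v) / 2` for `τ = u + i v`. -/
def dTauBar {m : ℕ} (F : ℂ → Fin m → ℂ) (z : ℂ) : Fin m → ℂ :=
  (1 / 2 : ℂ) • (fderiv ℝ F z 1 + Complex.I • fderiv ℝ F z Complex.I)

/-- The weight `k` hyperbolic Laplacian
`Δ_k = -4 v² ∂/∂τ ∂/∂τ̄ + 2 k i v ∂/∂τ̄`. -/
def laplacian {m : ℕ} (k : ℝ) (F : ℂ → Fin m → ℂ) (z : ℂ) : Fin m → ℂ :=
  (-4 * (z.im : ℂ) ^ 2) • dTau (dTauBar F) z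
    + (2 * (k : ℂ) * Complex.I * (z.im : ℂ)) • dTauBar F z

/-! ### Fourier expansions -/

/-- The incomplete gamma function `Γ(a, w) = ∫_w^∞ e^{-t} t^{a-1} dt`
(used for `w > 0`, where the integral converges for every real `a`). -/
def incGamma (a w : ℝ) : ℝ :=
  ∫ t in Set.Ioi w, Real.exp (-t) * t ^ (a - 1)

/-- `c e^{2πi (n + κ) τ}`. -/
def holTerm (κ : ℝ) (c : ℤ → ℂ) (τ : ℍ) (n : ℤ) : ℂ :=
  c n * Complex.exp (2 * Real.pi * Complex.I * ((n : ℂ) + (κ : ℂ)) * (τ : ℂ))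

/-- `c Γ(1 - k, -4π (n + κ) v) e^{2πi (n + κ) τ}`. -/
def nonholTerm (k κ : ℝ) (c : ℤ → ℂ) (τ : ℍ) (n : ℤ) : ℂ :=
  c n * (incGamma (1 - k) (-4 * Real.pi * ((n : ℝ) + κ) * τ.im) : ℂ) *
    Complex.exp (2 * Real.pi * Complex.I * ((n : ℂ) + (κ : ℂ)) * (τ : ℂ))

/-- The function on the upper half plane with `j`-th component
`∑_{n ≥ -n₀} c⁺_j(n) e^{2πi (n + κ_j) τ}
  + ∑_{n + κ_j < 0} c⁻_j(n) Γ(1 - k, -4π (n + κ_j) v) e^{2πi (n + κ_j) τ}`. -/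
def maassSeries {m : ℕ} (k : ℝ) (κ : Fin m → ℝ) (n₀ : ℕ) (cp cm : Fin m → ℤ → ℂ)
    (τ : ℍ) : Fin m → ℂ := fun j =>
  (∑' n : {n : ℤ // -(n₀ : ℤ) ≤ n}, holTerm (κ j) (cp j) τ n)
    + ∑' n : {n : ℤ // (n : ℝ) + κ j < 0}, nonholTerm k (κ j) (cm j) τ n

/-- `f` belongs to `H_{k,χ,ρ}`. The numbers `κ_j ∈ [0, 1)` are those for which
`χ(T) ρ(T) e_j = e^{2πi κ_j} e_j`. -/
structure IsHarmonicWeakMaassForm {m : ℕ} (k : ℝ) (χ : SL(2, ℤ) → ℂ)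
    (ρ : SL(2, ℤ) →* Matrix.unitaryGroup (Fin m) ℂ) (κ : Fin m → ℝ)
    (f : ℍ → Fin m → ℂ) : Prop where
  realAnalytic : AnalyticOnNhd ℝ (fun z : ℂ => f (UpperHalfPlane.ofComplex z)) {z | 0 < z.im}
  slash_eq : ∀ γ : SL(2, ℤ), slash k χ ρ f γ = f
  harmonic : ∀ z : ℂ, 0 < z.im →
    laplacian k (fun z : ℂ => f (UpperHalfPlane.ofComplex z)) z = 0
  fourier : ∃ (n₀ : ℕ) (cp cm : Fin m → ℤ → ℂ), ∀ (τ : ℍ),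
    (∀ j, Summable fun n : {n : ℤ // -(n₀ : ℤ) ≤ n} => holTerm (κ j) (cp j) τ n) ∧
    (∀ j, Summable fun n : {n : ℤ // (n : ℝ) + κ j < 0} => nonholTerm k (κ j) (cm j) τ n) ∧
    f τ = maassSeries k κ n₀ cp cm τ

/-! ### Test functions

Functions on `(0, ∞)` with compact support are extended by zero to `ℝ`. -/

/-- `φ_s(x) = φ(x) x^{s-1}`. -/
def twist (φ : ℝ → ℂ) (s : ℂ) (x : ℝ) : ℂ := φ x * (x : ℂ) ^ (s - 1)

/-- `(φ |_{2-k,χ⁻¹} S)(x) = x^{k-2} χ(S) φ(1/x)`. -/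
def testSlash (k : ℝ) (χ : SL(2, ℤ) → ℂ) (φ : ℝ → ℂ) (x : ℝ) : ℂ :=
  ((x ^ (k - 2) : ℝ) : ℂ) * χ ModularGroup.S * φ (1 / x)

/-- Complex-valued, compactly supported, piecewise smooth functions on `(0, ∞)`. Piecewise
smoothness: to the left and to the right of each point, `φ` agrees with a function that is smooth
across the point, and the value of `φ` at the point is one of the two one-sided limits. By
compactness, there are only finitely many break points. -/
structure IsTestFunction (φ : ℝ → ℂ) : Prop where
  compactSupport : HasCompactSupport φ
  support_pos : tsupport φ ⊆ Set.Ioi 0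
  piecewiseSmooth : ∀ x : ℝ, 0 < x → ∃ ε > 0, ∃ g h : ℝ → ℂ,
    ContDiffOn ℝ ∞ g (Set.Ioo (x - ε) (x + ε)) ∧
    ContDiffOn ℝ ∞ h (Set.Ioo (x - ε) (x + ε)) ∧
    (∀ y ∈ Set.Ioo (x - ε) x, φ y = g y) ∧
    (∀ y ∈ Set.Ioo x (x + ε), φ y = h y) ∧
    (φ x = g x ∨ φ x = h x)

/-- A set `S_c(ℝ₊)` of test functions: no point of `(0, ∞)` is a common zero, and
`φ_s` lies in the set whenever `φ` does. -/
structure IsTestSpace (Sc : Set (ℝ → ℂ)) : Prop where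
  isTestFunction : ∀ φ ∈ Sc, IsTestFunction φ
  exists_ne_zero : ∀ y : ℝ, 0 < y → ∃ φ ∈ Sc, φ y ≠ 0
  twist_mem : ∀ φ ∈ Sc, ∀ s : ℂ, twist φ s ∈ Sc

/-- The set of all test functions is a test space. -/
theorem isTestSpace_all : IsTestSpace {φ | IsTestFunction φ} where
  isTestFunction _ h := h
  exists_ne_zero y hy := by
    let b : ContDiffBump y := ⟨y / 4, y / 2, by positivity, by linarith⟩
    refine ⟨fun x => ((b x : ℝ) : ℂ), ⟨?_, ?_, ?_⟩, ?_⟩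
    · exact b.hasCompactSupport.comp_left (g := fun t : ℝ => (t : ℂ)) Complex.ofReal_zero
    · intro x hx
      have hx' : x ∈ tsupport b :=
        tsupport_comp_subset (g := fun t : ℝ => (t : ℂ)) Complex.ofReal_zero b hx
      rw [b.tsupport_eq, Real.closedBall_eq_Icc] at hx'
      have : y - y / 2 ≤ x := hx'.1
      simp only [Set.mem_Ioi]
      linarith
    · intro x _
      have hs : ContDiff ℝ ∞ (fun x => ((b x : ℝ) : ℂ)) :=
        Complex.ofRealCLM.contDiff.comp b.contDiff
      exact ⟨1, one_pos, _, _, hs.contDiffOn, hs.contDiffOn, fun _ _ => rfl, fun _ _ => rfl,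
        Or.inl rfl⟩
    · have : b y = 1 := b.one_of_mem_closedBall (Metric.mem_closedBall_self b.rIn_pos.le)
      simp [this]
  twist_mem φ hφ s := by
    refine ⟨hφ.compactSupport.mul_right, ?_, ?_⟩
    · exact (tsupport_mul_subset_left (f := φ) (g := fun x : ℝ => (x : ℂ) ^ (s - 1))).trans
        hφ.support_pos
    · intro x hx
      obtain ⟨ε, hε, g, h, hg, hh, hgl, hhr, hv⟩ := hφ.piecewiseSmooth x hx
      have hp : ContDiffOn ℝ ∞ (fun y : ℝ => (y : ℂ) ^ (s - 1)) (Set.Ioi 0) := by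
        have : ContDiffOn ℝ ∞ (fun y : ℝ => Complex.exp (((Real.log y : ℝ) : ℂ) * (s - 1)))
            (Set.Ioi 0) := by
          have hl : ContDiffOn ℝ ∞ (fun y : ℝ => ((Real.log y : ℝ) : ℂ)) (Set.Ioi 0) :=
            Complex.ofRealCLM.contDiff.comp_contDiffOn
              (Real.contDiffOn_log.mono fun y (hy : 0 < y) => hy.ne')
          exact (hl.mul contDiffOn_const).cexp
        refine this.congr fun y (hy : 0 < y) => ?_
        rw [Complex.cpow_def_of_ne_zero (by exact_mod_cast hy.ne'), Complex.ofReal_log hy.le]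
      have hsub : Set.Ioo (x - min ε x) (x + min ε x) ⊆ Set.Ioo (x - ε) (x + ε) :=
        Set.Ioo_subset_Ioo (by linarith [min_le_left ε x]) (by linarith [min_le_left ε x])
      have hpos : Set.Ioo (x - min ε x) (x + min ε x) ⊆ Set.Ioi 0 := fun y hy => by
        have := hy.1
        simp only [Set.mem_Ioi]
        linarith [min_le_right ε x]
      refine ⟨min ε x, lt_min hε hx, fun y => g y * (y : ℂ) ^ (s - 1),
        fun y => h y * (y : ℂ) ^ (s - 1), (hg.mono hsub).mul (hp.mono hpos),
        (hh.mono hsub).mul (hp.mono hpos), ?_, ?_, ?_⟩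
      · intro y hy
        simp only [twist]
        rw [hgl y ⟨by linarith [hy.1, min_le_left ε x], hy.2⟩]
      · intro y hy
        simp only [twist]
        rw [hhr y ⟨hy.1, by linarith [hy.2, min_le_left ε x]⟩]
      · rcases hv with hv | hv
        · left; simp only [twist]; rw [hv]
        · right; simp only [twist]; rw [hv]

/-! ### The `L`-series -/

/-- The Laplace transform `(ℒφ)(s) = ∫_0^∞ e^{-st} φ(t) dt`. -/
def laplace (φ : ℝ → ℂ) (s : ℂ) : ℂ :=
  ∫ t in Set.Ioi (0 : ℝ), Complex.exp (-s * t) * φ t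

/-- `x^{1-k} ∫_0^∞ (ℒψ)(x (2t+1) / 2) (1+t)^{-k} dt`, where `x = -4π (n + κ)`. -/
def nonholKernel (k κ : ℝ) (ψ : ℝ → ℂ) (n : ℤ) : ℂ :=
  (((-4 * Real.pi * ((n : ℝ) + κ)) ^ (1 - k) : ℝ) : ℂ) *
    ∫ t in Set.Ioi (0 : ℝ),
      laplace ψ ((-2 * Real.pi * ((n : ℝ) + κ) * (2 * t + 1) : ℝ) : ℂ) /
        (((1 + t) ^ k : ℝ) : ℂ)

/-- `L_f(φ)`. All series and integrals converge absolutely when `φ` is a test function and the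
coefficients are `O(e^{C√|n|})`. -/
def Lf {m : ℕ} (k : ℝ) (κ : Fin m → ℝ) (n₀ : ℕ) (cp cm : Fin m → ℤ → ℂ)
    (φ : ℝ → ℂ) : Fin m → ℂ := fun j =>
  (∑' n : {n : ℤ // -(n₀ : ℤ) ≤ n},
      cp j n * laplace φ ((2 * Real.pi * (((n : ℤ) : ℝ) + κ j) : ℝ) : ℂ))
    + ∑' n : {n : ℤ // (n : ℝ) + κ j < 0},
      cm j n * nonholKernel k (κ j) (twist φ (2 - k)) n

/-- `L_{δ_k f}(φ)`, where `δ_k f = τ ∂f/∂u + (k/2) f`. -/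
def Ldeltaf {m : ℕ} (k : ℝ) (κ : Fin m → ℝ) (n₀ : ℕ) (cp cm : Fin m → ℤ → ℂ)
    (φ : ℝ → ℂ) : Fin m → ℂ := fun j =>
  ((k : ℂ) / 2) * Lf k κ n₀ cp cm φ j
    - 2 * Real.pi * (∑' n : {n : ℤ // -(n₀ : ℤ) ≤ n},
      cp j n * ((((n : ℤ) : ℝ) + κ j : ℝ) : ℂ) *
        laplace (twist φ 2) ((2 * Real.pi * (((n : ℤ) : ℝ) + κ j) : ℝ) : ℂ))
    - 2 * Real.pi * (∑' n : {n : ℤ // (n : ℝ) + κ j < 0},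
      cm j n * ((((n : ℤ) : ℝ) + κ j : ℝ) : ℂ) *
        nonholKernel k (κ j) (twist φ (3 - k)) n)

end VVMaass

end

/-!
The series `(*)` has `∂f/∂τ̄ = v^{-k} H(-τ̄)` with a holomorphic function `H`, its shadow; in
particular it is harmonic. Evaluated against test functions, the two hypotheses on `L`-series say
that `f` and `δ_k f` satisfy the functional equations under `τ ↦ -1/τ` on the imaginary axis,
because `L_f(φ)` and `L_{δ_k f}(φ)` are the integrals of `φ` against `f(iy)` and `(δ_k f)(iy)`.

Let `g(τ) = f(-1/τ) - τ^k M f(τ)`, where `M = χ(S) ρ(S)`, be the defect of the functional equation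
of `f`. On the imaginary axis the first equation gives `g = 0`, hence `∂g/∂v = 0`, and the second
then gives `∂g/∂u = 0`. Therefore `∂g/∂τ̄` vanishes on the imaginary axis. Up to a nonvanishing
factor it is a holomorphic function of `-τ̄`, so it vanishes identically by the identity theorem.
Now `g` itself is holomorphic and vanishes on the imaginary axis, so `g = 0`. The behaviour under
`τ ↦ τ + 1` is visible in `(*)`, and these two maps generate the modular group.
-/

noncomputable section

namespace VVMaass

open MeasureTheory Set Filter Complex ComplexConjugate

/-! ### The incomplete gamma function on the right half plane -/

section IncompleteGamma

lemma exists_rpow_le_const_mul_exp (p : ℝ) {δ t₀ : ℝ} (hδ : 0 < δ) (ht₀ : 0 < t₀) :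
    ∃ C > 0, ∀ t ≥ t₀, t ^ p ≤ C * Real.exp (δ * t) := by
  obtain ⟨N, hN⟩ := exists_nat_ge p
  refine ⟨t₀ ^ p * (N.factorial / (δ * t₀) ^ N), by positivity, fun t ht => ?_⟩
  have htpos : 0 < t := ht₀.trans_le ht
  calc t ^ p = t₀ ^ p * (t / t₀) ^ p := by
        rw [← Real.mul_rpow ht₀.le (by positivity), mul_div_cancel₀ _ ht₀.ne']
    _ ≤ t₀ ^ p * (t / t₀) ^ N := by
        rw [← Real.rpow_natCast]
        gcongr
        exact (one_le_div ht₀).2 ht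
    _ = t₀ ^ p * (N.factorial / (δ * t₀) ^ N) * ((δ * t) ^ N / N.factorial) := by
        rw [div_pow, mul_pow, mul_pow]
        field_simp
    _ ≤ t₀ ^ p * (N.factorial / (δ * t₀) ^ N) * Real.exp (δ * t) := by
        gcongr
        exact Real.pow_div_factorial_le_exp _ (by positivity) N

lemma continuousOn_ofReal_rpow (p : ℝ) : ContinuousOn (fun y : ℝ => ((y ^ p : ℝ) : ℂ)) (Ioi 0) :=
  continuous_ofReal.comp_continuousOn fun y (hy : 0 < y) =>
    (Real.continuousAt_rpow_const y p (Or.inl hy.ne')).continuousWithinAt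

lemma continuousOn_exp_neg_mul_rpow (p : ℝ) :
    ContinuousOn (fun t : ℝ => Real.exp (-t) * t ^ p) (Ioi 0) := fun t (ht : 0 < t) =>
  ContinuousAt.continuousWithinAt (by fun_prop (disch := simp [ht.ne']))

lemma integrableOn_exp_neg_mul_rpow (p : ℝ) {y : ℝ} (hy : 0 < y) :
    IntegrableOn (fun t : ℝ => Real.exp (-t) * t ^ p) (Ioi y) := by
  refine integrable_of_isBigO_exp_neg one_half_pos
    ((continuousOn_exp_neg_mul_rpow p).mono (Ici_subset_Ioi.2 hy)) ?_
  simpa using (Real.Gamma_integrand_isLittleO p).isBigO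

lemma integrableOn_exp_neg_mul_mul_one_add_rpow (p : ℝ) {ε : ℝ} (hε : 0 < ε) :
    IntegrableOn (fun t : ℝ => Real.exp (-ε * t) * (1 + t) ^ p) (Ioi 0) := by
  obtain ⟨C, -, hpC⟩ := exists_rpow_le_const_mul_exp p (half_pos hε) one_pos
  refine integrable_of_isBigO_exp_neg (half_pos hε) (fun t (ht : 0 ≤ t) => ?_) ?_
  · have : 1 + t ≠ 0 := by positivity
    exact ContinuousAt.continuousWithinAt (by fun_prop (disch := simp [this]))
  · refine Asymptotics.IsBigO.of_bound (C * Real.exp (ε / 2)) ?_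
    filter_upwards [eventually_ge_atTop 0] with t ht
    rw [Real.norm_of_nonneg (by positivity), Real.norm_of_nonneg (by positivity)]
    calc Real.exp (-ε * t) * (1 + t) ^ p
        ≤ Real.exp (-ε * t) * (C * Real.exp (ε / 2 * (1 + t))) := by
          gcongr
          exact hpC _ (by linarith)
      _ = C * Real.exp (ε / 2) * Real.exp (-(ε / 2) * t) := by
          rw [mul_left_comm, ← Real.exp_add, mul_assoc, ← Real.exp_add]
          ring_nf

/-- The function `∫_0^∞ e^{-wt} (1+t)^{-k} dt` of `w` in the right half plane, which is Tricomi's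
confluent hypergeometric function `U(1, 2 - k, w)`. It carries the dependence of `Γ(1 - k, w)`
on `w` apart from elementary factors. -/
def tricomi (k : ℝ) (w : ℂ) : ℂ :=
  ∫ t in Ioi (0 : ℝ), exp (-w * t) * (((1 + t) ^ (-k) : ℝ) : ℂ)

lemma aestronglyMeasurable_tricomi_integrand (k : ℝ) (w : ℂ) :
    AEStronglyMeasurable (fun t : ℝ => exp (-w * t) * (((1 + t) ^ (-k) : ℝ) : ℂ))
      (volume.restrict (Ioi 0)) := by
  have hpow : ContinuousOn (fun t : ℝ => (((1 + t) ^ (-k) : ℝ) : ℂ)) (Ioi 0) :=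
    (continuousOn_ofReal_rpow (-k)).comp (by fun_prop) fun t (ht : 0 < t) =>
      show 0 < 1 + t by positivity
  exact ContinuousOn.aestronglyMeasurable (by fun_prop) measurableSet_Ioi

lemma norm_tricomi_integrand_le (k : ℝ) {ε : ℝ} {w : ℂ} (hw : ε ≤ w.re) {t : ℝ} (ht : 0 < t) :
    ‖exp (-w * t) * (((1 + t) ^ (-k) : ℝ) : ℂ)‖ ≤ Real.exp (-ε * t) * (1 + t) ^ (-k) := by
  rw [norm_mul, norm_exp, norm_real, Real.norm_of_nonneg (by positivity), re_mul_ofReal, neg_re]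
  gcongr

lemma norm_tricomi_le (k : ℝ) {ε : ℝ} (hε : 0 < ε) {w : ℂ} (hw : ε ≤ w.re) :
    ‖tricomi k w‖ ≤ ∫ t in Ioi (0 : ℝ), Real.exp (-ε * t) * (1 + t) ^ (-k) :=
  norm_integral_le_of_norm_le (integrableOn_exp_neg_mul_mul_one_add_rpow _ hε)
    (ae_restrict_of_forall_mem measurableSet_Ioi fun _ ht => norm_tricomi_integrand_le _ hw ht)

lemma integrableOn_tricomi_integrand (k : ℝ) {w : ℂ} (hw : 0 < w.re) :
    IntegrableOn (fun t : ℝ => exp (-w * t) * (((1 + t) ^ (-k) : ℝ) : ℂ)) (Ioi 0) :=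
  (integrableOn_exp_neg_mul_mul_one_add_rpow _ hw).mono'
    (aestronglyMeasurable_tricomi_integrand k w)
    (ae_restrict_of_forall_mem measurableSet_Ioi fun _ ht =>
      norm_tricomi_integrand_le _ le_rfl ht)

lemma differentiableAt_tricomi (k : ℝ) {w : ℂ} (hw : 0 < w.re) :
    DifferentiableAt ℂ (tricomi k) w := by
  have hnhds : {z : ℂ | w.re / 2 < z.re} ∈ 𝓝 w :=
    (isOpen_lt continuous_const continuous_re).mem_nhds (half_lt_self hw)
  have hderiv := hasDerivAt_integral_of_dominated_loc_of_deriv_le (𝕜 := ℂ)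
    (μ := volume.restrict (Ioi (0 : ℝ)))
    (F := fun z t => exp (-z * t) * (((1 + t) ^ (-k) : ℝ) : ℂ))
    (F' := fun z t => -(t : ℂ) * (exp (-z * t) * (((1 + t) ^ (-k) : ℝ) : ℂ)))
    (bound := fun t => Real.exp (-(w.re / 2) * t) * (1 + t) ^ (-k + 1))
    hnhds (Eventually.of_forall fun z => aestronglyMeasurable_tricomi_integrand _ z)
    (integrableOn_tricomi_integrand k hw)
    (AEStronglyMeasurable.mul (by fun_prop) (aestronglyMeasurable_tricomi_integrand _ w))
    (ae_restrict_of_forall_mem measurableSet_Ioi fun t (ht : 0 < t) z hz => ?_)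
    (integrableOn_exp_neg_mul_mul_one_add_rpow _ (half_pos hw)) (ae_of_all _ fun t z _ => ?_)
  · exact hderiv.2.differentiableAt
  · rw [norm_mul, norm_neg, norm_real, Real.norm_of_nonneg ht.le,
      Real.rpow_add_one (by positivity)]
    calc t * ‖exp (-z * t) * (((1 + t) ^ (-k) : ℝ) : ℂ)‖
        ≤ (1 + t) * (Real.exp (-(w.re / 2) * t) * (1 + t) ^ (-k)) := by
          gcongr
          · linarith
          · exact norm_tricomi_integrand_le k (le_of_lt hz) ht
      _ = Real.exp (-(w.re / 2) * t) * ((1 + t) ^ (-k) * (1 + t)) := by ring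
  · have hlin : HasDerivAt (fun z : ℂ => -z * t) (-(t : ℂ)) z := by
      simpa using (hasDerivAt_id z).neg.mul_const (t : ℂ)
    convert! hlin.cexp.mul_const (((1 + t) ^ (-k) : ℝ) : ℂ) using 1
    ring

lemma tricomi_ofReal (k x : ℝ) :
    tricomi k x = ((∫ t in Ioi (0 : ℝ), Real.exp (-x * t) * (1 + t) ^ (-k) : ℝ) : ℂ) := by
  rw [tricomi, ← integral_complex_ofReal]
  simp

lemma incGamma_eq_integral (k : ℝ) {x : ℝ} (hx : 0 < x) :
    incGamma (1 - k) x = x ^ (1 - k) * Real.exp (-x) *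
      ∫ t in Ioi (0 : ℝ), Real.exp (-x * t) * (1 + t) ^ (-k) := by
  have hscale := integral_comp_mul_left_Ioi (fun t => Real.exp (-t) * t ^ (1 - k - 1)) 1 hx
  have hshift := (measurePreserving_add_left volume (1 : ℝ)).setIntegral_preimage_emb
    (measurableEmbedding_addLeft 1) (fun t => Real.exp (-(x * t)) * (x * t) ^ (1 - k - 1)) (Ioi 1)
  rw [preimage_const_add_Ioi, sub_self] at hshift
  rw [← hshift, mul_one, smul_eq_mul, ← incGamma, eq_inv_mul_iff_mul_eq₀ hx.ne'] at hscale
  rw [← hscale, ← integral_const_mul, ← integral_const_mul]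
  refine setIntegral_congr_fun measurableSet_Ioi fun t (ht : 0 < t) => ?_
  rw [Real.mul_rpow hx.le (by positivity), show 1 - k - 1 = -k by ring,
    show -(x * (1 + t)) = -x + -x * t by ring, Real.exp_add, sub_eq_add_neg, Real.rpow_add hx,
    Real.rpow_one]
  ring

lemma hasDerivAt_incGamma (a : ℝ) {x : ℝ} (hx : 0 < x) :
    HasDerivAt (incGamma a) (-(Real.exp (-x) * x ^ (a - 1))) x := by
  have hx2 : 0 < x / 2 := half_pos hx
  have hint : IntegrableOn (fun t : ℝ => Real.exp (-t) * t ^ (a - 1)) (Ioi (x / 2)) :=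
    integrableOn_exp_neg_mul_rpow _ hx2
  have hcont := continuousOn_exp_neg_mul_rpow (a - 1)
  have hftc : HasDerivAt (fun u => ∫ t in (x / 2)..u, Real.exp (-t) * t ^ (a - 1))
      (Real.exp (-x) * x ^ (a - 1)) x :=
    intervalIntegral.integral_hasDerivAt_right
      ((intervalIntegrable_iff_integrableOn_Ioc_of_le (by linarith)).2
        (hint.mono_set Ioc_subset_Ioi_self))
      (hcont.stronglyMeasurableAtFilter isOpen_Ioi x hx) (hcont.continuousAt (Ioi_mem_nhds hx))
  refine (hftc.const_sub (incGamma a (x / 2))).congr_of_eventuallyEq ?_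
  filter_upwards [Ioi_mem_nhds (half_lt_self hx)] with u (hu : x / 2 < u)
  rw [eq_sub_iff_add_eq, add_comm]
  exact intervalIntegral.integral_interval_add_Ioi hint (hint.mono_set (Ioi_subset_Ioi hu.le))

/-- The holomorphic extension of `w ↦ Γ(1 - k, w)` to the right half plane. -/
def cIncGamma (k : ℝ) (w : ℂ) : ℂ :=
  w ^ ((1 - k : ℝ) : ℂ) * exp (-w) * tricomi k w

lemma cIncGamma_ofReal (k : ℝ) {x : ℝ} (hx : 0 < x) :
    cIncGamma k x = (incGamma (1 - k) x : ℂ) := by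
  rw [cIncGamma, tricomi_ofReal, incGamma_eq_integral k hx, ← ofReal_cpow hx.le]
  push_cast
  rfl

lemma differentiableAt_cIncGamma (k : ℝ) {w : ℂ} (hw : 0 < w.re) :
    DifferentiableAt ℂ (cIncGamma k) w :=
  ((differentiableAt_id.cpow_const (Or.inl hw)).mul (by fun_prop)).mul
    (differentiableAt_tricomi k hw)

lemma deriv_cIncGamma_ofReal (k : ℝ) {x : ℝ} (hx : 0 < x) :
    deriv (cIncGamma k) x = -((Real.exp (-x) * x ^ (-k) : ℝ) : ℂ) := by
  have hcomplex :=
    (differentiableAt_cIncGamma k (w := x) (by simpa using hx)).hasDerivAt.comp_ofReal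
  have hreal : HasDerivAt (fun y : ℝ => cIncGamma k y)
      ((-(Real.exp (-x) * x ^ (1 - k - 1)) : ℝ) : ℂ) x := by
    refine (hasDerivAt_incGamma (1 - k) hx).ofReal_comp.congr_of_eventuallyEq ?_
    filter_upwards [Ioi_mem_nhds hx] with y hy using cIncGamma_ofReal k hy
  rw [hcomplex.unique hreal, sub_sub_cancel_left, ofReal_neg]

lemma exists_norm_cIncGamma_le (k : ℝ) {ε δ : ℝ} (hε : 0 < ε) (hδ : 0 < δ) :
    ∃ C ≥ 0, ∀ w : ℂ, ε ≤ w.re → ‖cIncGamma k w‖ ≤ C * Real.exp (δ * ‖w‖ - w.re) := by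
  obtain ⟨C, hC, hpow⟩ := exists_rpow_le_const_mul_exp (1 - k) hδ hε
  refine ⟨C * ∫ t in Ioi (0 : ℝ), Real.exp (-ε * t) * (1 + t) ^ (-k),
    mul_nonneg hC.le (setIntegral_nonneg measurableSet_Ioi fun t (ht : 0 < t) => by positivity),
    fun w hw => ?_⟩
  have hw0 : w ≠ 0 := by
    rintro rfl
    exact (hε.trans_le hw).ne' rfl
  have hcpow : ‖w ^ ((1 - k : ℝ) : ℂ)‖ ≤ C * Real.exp (δ * ‖w‖) := by
    rw [norm_cpow_of_ne_zero hw0]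
    simpa using hpow _ (hw.trans (re_le_norm w))
  have htricomi := norm_tricomi_le k hε hw
  rw [cIncGamma, norm_mul, norm_mul, norm_exp, neg_re]
  calc ‖w ^ ((1 - k : ℝ) : ℂ)‖ * Real.exp (-w.re) * ‖tricomi k w‖
      ≤ C * Real.exp (δ * ‖w‖) * Real.exp (-w.re) *
        ∫ t in Ioi (0 : ℝ), Real.exp (-ε * t) * (1 + t) ^ (-k) := by gcongr
    _ = _ := by
        rw [sub_eq_add_neg, Real.exp_add]
        ring

end IncompleteGamma

/-! ### Series of products of holomorphic functions of two variables -/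

section PairedSeries

variable {ι : Type*}

section Biorthogonal

variable {E : Type*} [NormedAddCommGroup E] [NormedSpace ℂ E]

lemma norm_smul_le_of_norm_le_one {c : ℂ} {r : ℝ} (hc : ‖c‖ ≤ r) {u : E} (hu : ‖u‖ ≤ 1) :
    ‖c • u‖ ≤ r := by
  rw [norm_smul]
  exact (mul_le_of_le_one_right (norm_nonneg _) hu).trans hc

lemma hasSum_deriv_smul_const [CompleteSpace E] {U : Set ℂ} (hU : IsOpen U) {α : ι → ℂ → ℂ}
    {r : ι → ℝ} (hr : Summable r) (hα : ∀ i, DifferentiableOn ℂ (α i) U)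
    (hαr : ∀ i, ∀ a ∈ U, ‖α i a‖ ≤ r i) {u : ι → E} (hu : ∀ i, ‖u i‖ ≤ 1) {a : ℂ} (ha : a ∈ U) :
    HasSum (fun i => deriv (α i) a • u i) (deriv (fun a => ∑' i, α i a • u i) a) := by
  have hderiv i : deriv (fun a => α i a • u i) a = deriv (α i) a • u i :=
    (((hα i).differentiableAt (hU.mem_nhds ha)).hasDerivAt.smul_const (u i)).deriv
  simpa only [hderiv] using hasSum_deriv_of_summable_norm hr
    (fun i => (hα i).smul_const (u i)) hU
    (fun i a ha => norm_smul_le_of_norm_le_one (hαr i a ha) (hu i)) ha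

open Classical in
lemma hasSum_mul_of_biorthogonal {L : ι → E →L[ℂ] ℂ} {e : ι → E}
    (hLe : ∀ i j, L i (e j) = if i = j then 1 else 0) {c d : ι → ℂ} {T : E →L[ℂ] ℂ} {y : E}
    (hT : HasSum (fun i => c i • L i) T) (hy : HasSum (fun i => d i • e i) y) :
    HasSum (fun i => c i * d i) (T y) := by
  have hcoord i : L i y = d i := by
    have hsingle : HasSum (fun j => L i (d j • e j)) (L i (d i • e i)) :=
      hasSum_single i fun j hj => by rw [map_smul, hLe, if_neg hj.symm, smul_zero]
    rw [((L i).hasSum hy).unique hsingle, map_smul, hLe, if_pos rfl, smul_eq_mul, mul_one]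
  simpa [hcoord] using (ContinuousLinearMap.apply ℂ ℂ y).hasSum hT

end Biorthogonal

variable {U W : Set ℂ} {α β : ι → ℂ → ℂ} {r s : ι → ℝ}

/- A series `∑ α i a * β i b` is the value of the functional `∑ α i a • L i` on `ℓ²` at the vector
`∑ β i b • e i`, where `e` is the standard basis and `L` consists of its coordinates. Both are
holomorphic in one variable, so their pairing is jointly analytic. -/
open Classical in
lemma exists_analyticAt_hasSum_mul (hU : IsOpen U) (hW : IsOpen W) (hr : Summable r)
    (hs : Summable s) (hα : ∀ i, DifferentiableOn ℂ (α i) U)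
    (hβ : ∀ i, DifferentiableOn ℂ (β i) W) (hαr : ∀ i, ∀ a ∈ U, ‖α i a‖ ≤ r i)
    (hβs : ∀ i, ∀ b ∈ W, ‖β i b‖ ≤ s i) {a₀ b₀ : ℂ} (ha₀ : a₀ ∈ U) (hb₀ : b₀ ∈ W) :
    ∃ G : ℂ × ℂ → ℂ, AnalyticAt ℂ G (a₀, b₀) ∧
      (∀ a ∈ U, ∀ b ∈ W, HasSum (fun i => α i a * β i b) (G (a, b))) ∧
      HasSum (fun i => deriv (α i) a₀ * β i b₀) (fderiv ℂ G (a₀, b₀) (1, 0)) ∧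
      HasSum (fun i => α i a₀ * deriv (β i) b₀) (fderiv ℂ G (a₀, b₀) (0, 1)) := by
  let e : ι → lp (fun _ : ι => ℂ) 2 := fun i => lp.single 2 i 1
  let L : ι → lp (fun _ : ι => ℂ) 2 →L[ℂ] ℂ := fun i => lp.evalCLM ℂ (fun _ => ℂ) 2 i
  have hLe i j : L i (e j) = if i = j then 1 else 0 := by
    change (e j : ι → ℂ) i = _
    rw [lp.single_apply, Pi.single_apply]
  have hL i : ‖L i‖ ≤ 1 := (L i).opNorm_le_bound zero_le_one fun y => by
    rw [one_mul]
    exact lp.norm_apply_le_norm two_ne_zero y i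
  have he i : ‖e i‖ ≤ 1 := by rw [lp.norm_single two_pos, norm_one]
  let A a := ∑' i, α i a • L i
  let B b := ∑' i, β i b • e i
  have hAU : DifferentiableOn ℂ A U :=
    differentiableOn_tsum_of_summable_norm hr (fun i => (hα i).smul_const _) hU
      fun i a ha => norm_smul_le_of_norm_le_one (hαr i a ha) (hL i)
  have hBW : DifferentiableOn ℂ B W :=
    differentiableOn_tsum_of_summable_norm hs (fun i => (hβ i).smul_const _) hW
      fun i b hb => norm_smul_le_of_norm_le_one (hβs i b hb) (he i)
  have hA a (ha : a ∈ U) : HasSum (fun i => α i a • L i) (A a) :=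
    (Summable.of_norm_bounded hr fun i =>
      norm_smul_le_of_norm_le_one (hαr i a ha) (hL i)).hasSum
  have hB b (hb : b ∈ W) : HasSum (fun i => β i b • e i) (B b) :=
    (Summable.of_norm_bounded hs fun i =>
      norm_smul_le_of_norm_le_one (hβs i b hb) (he i)).hasSum
  have hA' : HasFDerivAt (fun p : ℂ × ℂ => A p.1) _ (a₀, b₀) :=
    (hAU.differentiableAt (hU.mem_nhds ha₀)).hasDerivAt.hasFDerivAt.comp (g := A) (a₀, b₀)
      hasFDerivAt_fst
  have hB' : HasFDerivAt (fun p : ℂ × ℂ => B p.2) _ (a₀, b₀) :=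
    (hBW.differentiableAt (hW.mem_nhds hb₀)).hasDerivAt.hasFDerivAt.comp (g := B) (a₀, b₀)
      hasFDerivAt_snd
  refine ⟨fun p => A p.1 (B p.2), ?_,
    fun a ha b hb => hasSum_mul_of_biorthogonal hLe (hA a ha) (hB b hb), ?_, ?_⟩
  · have hAan : AnalyticAt ℂ (fun p : ℂ × ℂ => A p.1) (a₀, b₀) :=
      (hAU.analyticAt (hU.mem_nhds ha₀)).fun_comp analyticAt_fst
    have hBan : AnalyticAt ℂ (fun p : ℂ × ℂ => B p.2) (a₀, b₀) :=
      (hBW.analyticAt (hW.mem_nhds hb₀)).fun_comp analyticAt_snd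
    exact ((ContinuousLinearMap.id ℂ _).analyticAt_bilinear (A a₀, B b₀)).fun_comp
      (f := fun p : ℂ × ℂ => (A p.1, B p.2)) (hAan.prod hBan)
  · simpa [(hA'.clm_apply hB').fderiv] using
      hasSum_mul_of_biorthogonal hLe (hasSum_deriv_smul_const hU hr hα hαr hL ha₀) (hB b₀ hb₀)
  · simpa [(hA'.clm_apply hB').fderiv] using
      hasSum_mul_of_biorthogonal hLe (hA a₀ ha₀) (hasSum_deriv_smul_const hW hs hβ hβs he hb₀)

end PairedSeries

/-! ### Exponential series with coefficients of subexponential growth -/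

section Series

variable {ι : Type*} {x : ι → ℝ} {c d : ι → ℂ}

/-- The frequencies `x i` tend to infinity so fast that `∑ e^{-ε x i}` converges for every
`ε > 0`. -/
def FreqSummable (x : ι → ℝ) : Prop := ∀ ε > 0, Summable fun i => Real.exp (-ε * x i)

/-- The coefficients `c i` grow subexponentially in the frequencies `x i`. The bound is uniform
in `i`, including those with `x i < 0`. -/
def Subexp (x : ι → ℝ) (c : ι → ℂ) : Prop :=
  ∀ ε > 0, ∃ K ≥ 0, ∀ i, ‖c i‖ ≤ K * Real.exp (ε * x i)

lemma FreqSummable.const_mul {s : ℝ} (hs : 0 < s) (hx : FreqSummable x) :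
    FreqSummable fun i => s * x i := fun ε hε => by
  simpa only [neg_mul, mul_assoc] using hx (ε * s) (by positivity)

lemma FreqSummable.tendsto_atTop (hx : FreqSummable x) : Tendsto x cofinite atTop := by
  have h0 := (hx 1 one_pos).tendsto_cofinite_zero
  simpa [Function.comp_def] using Real.tendsto_exp_comp_nhds_zero.1 h0

lemma FreqSummable.exists_pos_forall_le (hx : FreqSummable x) (hpos : ∀ i, 0 < x i) :
    ∃ x₀ > 0, ∀ i, x₀ ≤ x i := by
  cases isEmpty_or_nonempty ι
  · exact ⟨1, one_pos, isEmptyElim⟩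
  · obtain ⟨i₀, hi₀⟩ := hx.tendsto_atTop.exists_forall_le
    exact ⟨x i₀, hpos i₀, hi₀⟩

lemma Subexp.comp_const_mul {s : ℝ} (hs : 0 < s) (hc : Subexp x c) :
    Subexp (fun i => s * x i) c := fun ε hε => by
  simpa only [mul_assoc] using hc (ε * s) (by positivity)

lemma Subexp.const_mul (a : ℂ) (hc : Subexp x c) : Subexp x fun i => a * c i := fun ε hε => by
  obtain ⟨K, hK, hcK⟩ := hc ε hε
  refine ⟨‖a‖ * K, by positivity, fun i => ?_⟩
  rw [norm_mul, mul_assoc]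
  gcongr
  exact hcK i

lemma Subexp.mul (hc : Subexp x c) (hd : Subexp x d) : Subexp x fun i => c i * d i :=
  fun ε hε => by
  obtain ⟨K, hK, hcK⟩ := hc (ε / 2) (half_pos hε)
  obtain ⟨M, hM, hdM⟩ := hd (ε / 2) (half_pos hε)
  refine ⟨K * M, by positivity, fun i => ?_⟩
  rw [norm_mul, ← add_halves ε, add_mul, Real.exp_add, mul_mul_mul_comm]
  exact mul_le_mul (hcK i) (hdM i) (norm_nonneg _) (by positivity)

lemma subexp_ofReal (hx : FreqSummable x) : Subexp x fun i => (x i : ℂ) := fun ε hε => by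
  have hsum := hx (2 * ε) (by positivity)
  refine ⟨ε⁻¹ * (1 + ∑' i, Real.exp (-(2 * ε) * x i)),
    mul_nonneg (by positivity) (add_nonneg zero_le_one (tsum_nonneg fun _ => Real.exp_nonneg _)),
    fun i => ?_⟩
  have hterm := hsum.le_tsum i fun _ _ => Real.exp_nonneg _
  have habs : ε * |x i| ≤ Real.exp (ε * x i) + Real.exp (-(ε * x i)) := by
    rw [← abs_of_pos hε, ← abs_mul, abs_of_pos hε]
    refine abs_le'.2 ⟨?_, ?_⟩
    · linarith [Real.add_one_le_exp (ε * x i), Real.exp_pos (-(ε * x i))]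
    · linarith [Real.add_one_le_exp (-(ε * x i)), Real.exp_pos (ε * x i)]
  rw [norm_real, Real.norm_eq_abs]
  calc |x i| = ε⁻¹ * (ε * |x i|) := by rw [inv_mul_cancel_left₀ hε.ne']
    _ ≤ ε⁻¹ * (Real.exp (ε * x i) + Real.exp (-(ε * x i))) := by gcongr
    _ = ε⁻¹ * (1 + Real.exp (-(2 * ε) * x i)) * Real.exp (ε * x i) := by
        rw [mul_assoc, add_mul, one_mul, ← Real.exp_add]
        ring_nf
    _ ≤ ε⁻¹ * (1 + ∑' i, Real.exp (-(2 * ε) * x i)) * Real.exp (ε * x i) := by gcongr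

lemma subexp_ofReal_rpow (hx : FreqSummable x) (hpos : ∀ i, 0 < x i) (p : ℝ) :
    Subexp x fun i => ((x i ^ p : ℝ) : ℂ) := fun ε hε => by
  obtain ⟨x₀, hx₀, hle⟩ := hx.exists_pos_forall_le hpos
  obtain ⟨C, hC, hpC⟩ := exists_rpow_le_const_mul_exp p hε hx₀
  refine ⟨C, hC.le, fun i => ?_⟩
  rw [norm_real, Real.norm_of_nonneg (Real.rpow_nonneg (hpos i).le p)]
  exact hpC _ (hle i)

/-- The series `∑ c i e^{i x z}`, in which `x` runs over the frequencies `x i`. It is the shape of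
the holomorphic part of a harmonic Maass form, and also of its shadow. -/
def holSeries (x : ι → ℝ) (c : ι → ℂ) (z : ℂ) : ℂ := ∑' i, c i * exp (I * x i * z)

lemma norm_exp_I_mul_ofReal_mul (t : ℝ) (z : ℂ) : ‖exp (I * t * z)‖ = Real.exp (-(t * z.im)) := by
  rw [norm_exp]
  simp

lemma exists_summable_norm_holSeries_le (hx : FreqSummable x) (hc : Subexp x c) {a b : ℝ}
    (ha : 0 < a) (hab : a ≤ b) : ∃ u : ι → ℝ, Summable u ∧
      ∀ i (z : ℂ), a ≤ z.im → z.im ≤ b → ‖c i * exp (I * x i * z)‖ ≤ u i := by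
  obtain ⟨K, hK, hcK⟩ := hc (a / 2) (half_pos ha)
  refine ⟨fun i => K * (Real.exp (-(a / 2) * x i) + Real.exp (-(b - a / 2) * x i)),
    ((hx _ (half_pos ha)).add (hx _ (by linarith))).mul_left K, fun i z haz hzb => ?_⟩
  have hexp : Real.exp (-(x i * z.im)) ≤ Real.exp (-(x i * a)) + Real.exp (-(x i * b)) := by
    rcases le_or_gt 0 (x i) with h0 | h0
    · exact le_add_of_le_of_nonneg (by gcongr) (Real.exp_nonneg _)
    · exact le_add_of_nonneg_of_le (Real.exp_nonneg _) (Real.exp_le_exp.2 (by nlinarith))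
  rw [norm_mul, norm_exp_I_mul_ofReal_mul]
  calc ‖c i‖ * Real.exp (-(x i * z.im))
      ≤ K * Real.exp (a / 2 * x i) * (Real.exp (-(x i * a)) + Real.exp (-(x i * b))) := by
        gcongr
        exact hcK i
    _ = K * (Real.exp (-(a / 2) * x i) + Real.exp (-(b - a / 2) * x i)) := by
        rw [mul_assoc, mul_add, ← Real.exp_add, ← Real.exp_add]
        ring_nf

lemma summable_holSeries (hx : FreqSummable x) (hc : Subexp x c) {z : ℂ} (hz : 0 < z.im) :
    Summable fun i => c i * exp (I * x i * z) := by
  obtain ⟨u, hu, hle⟩ := exists_summable_norm_holSeries_le hx hc hz le_rfl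
  exact .of_norm_bounded hu fun i => hle i z le_rfl le_rfl

lemma hasDerivAt_holSeries (hx : FreqSummable x) (hc : Subexp x c) {z : ℂ} (hz : 0 < z.im) :
    HasDerivAt (holSeries x c) (holSeries x (fun i => I * x i * c i) z) z := by
  obtain ⟨u, hu, hle⟩ := exists_summable_norm_holSeries_le hx hc (half_pos hz)
    (show z.im / 2 ≤ 2 * z.im by linarith)
  let U : Set ℂ := {w | w.im ∈ Ioo (z.im / 2) (2 * z.im)}
  have hU : IsOpen U := isOpen_Ioo.preimage continuous_im
  have hzU : z ∈ U := ⟨by linarith, by linarith⟩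
  have hterm i (w : ℂ) : HasDerivAt (fun w => c i * exp (I * x i * w))
      (I * x i * c i * exp (I * x i * w)) w := by
    have hlin : HasDerivAt (fun w : ℂ => I * x i * w) (I * x i) w := by
      simpa using (hasDerivAt_id w).const_mul (I * x i : ℂ)
    convert! hlin.cexp.const_mul (c i) using 1
    ring
  have hdiff i : DifferentiableOn ℂ (fun w => c i * exp (I * x i * w)) U := fun w _ =>
    (hterm i w).differentiableAt.differentiableWithinAt
  have hle' i w (hw : w ∈ U) := hle i w hw.1.le hw.2.le
  have hderiv := (hasSum_deriv_of_summable_norm hu hdiff hU hle' hzU).tsum_eq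
  simp only [(hterm _ z).deriv] at hderiv
  rw [holSeries, hderiv]
  exact ((differentiableOn_tsum_of_summable_norm hu hdiff hU hle').differentiableAt
    (hU.mem_nhds hzU)).hasDerivAt

/-- The series `∑ c i Γ(1 - k, x v) e^{-i x z / 2}` with `v = im z`, the shape of the
non-holomorphic part of a harmonic Maass form. -/
def nonholSeries (k : ℝ) (x : ι → ℝ) (c : ι → ℂ) (z : ℂ) : ℂ :=
  ∑' i, c i * (incGamma (1 - k) (x i * z.im) : ℂ) * exp (-(I * x i / 2) * z)

/-- The holomorphic function `H` for which the `τ̄`-derivative of the non-holomorphic series at `z`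
is `v^{-k} H(-z̄)`. -/
def shadowSeries (k : ℝ) (x : ι → ℝ) (c : ι → ℂ) : ℂ → ℂ :=
  holSeries (fun i => 1 / 2 * x i) fun i => -(I / 2) * (((x i ^ (1 - k) : ℝ) : ℂ) * c i)

lemma exists_summable_norm_mul_exp_le (hx : FreqSummable x) (hpos : ∀ i, 0 < x i)
    (hc : Subexp x c) {p q : ℝ} (hpq : p < q) :
    ∃ r : ι → ℝ, Summable r ∧ ∀ i (a : ℂ), a.im ≤ 2 * p →
      ‖c i * exp (-(I * x i / 2) * a) * Real.exp (-(q * x i))‖ ≤ r i := by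
  obtain ⟨K, hK, hcK⟩ := hc ((q - p) / 2) (by linarith)
  refine ⟨fun i => K * Real.exp (-((q - p) / 2) * x i), (hx _ (by linarith)).mul_left K,
    fun i a ha => ?_⟩
  have hfreq : -(I * x i / 2) * a = I * ((-(x i / 2) : ℝ) : ℂ) * a := by
    push_cast
    ring
  have him := mul_le_mul_of_nonneg_left ha (hpos i).le
  rw [norm_mul, norm_mul, hfreq, norm_exp_I_mul_ofReal_mul, norm_real,
    Real.norm_of_nonneg (Real.exp_nonneg _)]
  calc ‖c i‖ * Real.exp (-(-(x i / 2) * a.im)) * Real.exp (-(q * x i))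
      ≤ K * Real.exp ((q - p) / 2 * x i) * Real.exp (p * x i) * Real.exp (-(q * x i)) := by
        gcongr
        · exact hcK i
        · linarith
    _ = K * Real.exp (-((q - p) / 2) * x i) := by
        rw [mul_assoc, mul_assoc, ← Real.exp_add, ← Real.exp_add]
        ring_nf

lemma exists_summable_norm_cIncGamma_mul_exp_le (k : ℝ) (hx : FreqSummable x)
    (hpos : ∀ i, 0 < x i) {p q R : ℝ} (hp : 0 < p) (hqp : q < p) (hR : 0 < R) :
    ∃ s : ι → ℝ, Summable s ∧ ∀ i (b : ℂ), p ≤ b.re → ‖b‖ ≤ R →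
      ‖cIncGamma k (x i * b) * Real.exp (q * x i)‖ ≤ s i := by
  obtain ⟨x₀, hx₀, hle⟩ := hx.exists_pos_forall_le hpos
  obtain ⟨δ, hδ, hδR⟩ : ∃ δ > 0, δ * R = (p - q) / 2 :=
    ⟨(p - q) / 2 / R, div_pos (by linarith) hR, div_mul_cancel₀ _ hR.ne'⟩
  obtain ⟨C, hC, hΓ⟩ := exists_norm_cIncGamma_le k (mul_pos hx₀ hp) hδ
  refine ⟨fun i => C * Real.exp (-((p - q) / 2) * x i), (hx _ (by linarith)).mul_left C,
    fun i b hb hbR => ?_⟩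
  have hxi := (hpos i).le
  have hre : ((x i : ℂ) * b).re = x i * b.re := re_ofReal_mul _ _
  have hbound := hΓ (x i * b) (hre ▸ mul_le_mul (hle i) hb hp.le hxi)
  rw [hre, norm_mul, norm_real, Real.norm_of_nonneg hxi] at hbound
  rw [norm_mul, norm_real, Real.norm_of_nonneg (Real.exp_nonneg _)]
  calc ‖cIncGamma k (x i * b)‖ * Real.exp (q * x i)
      ≤ C * Real.exp (δ * (x i * R) - x i * p) * Real.exp (q * x i) := by
        grw [hbound, hbR, hb]
    _ = C * Real.exp (-((p - q) / 2) * x i) := by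
        rw [mul_assoc, ← Real.exp_add]
        congr 2
        linear_combination x i * hδR

lemma hasDerivAt_cIncGamma_mul (k : ℝ) {t : ℝ} (ht : 0 < t) {b : ℂ} (hb : 0 < b.re) :
    HasDerivAt (fun b => cIncGamma k (t * b)) (t * deriv (cIncGamma k) (t * b)) b := by
  have hlin : HasDerivAt (fun b : ℂ => (t : ℂ) * b) t b := by
    simpa using (hasDerivAt_id b).const_mul (t : ℂ)
  have hre : 0 < ((t : ℂ) * b).re := by
    rw [re_ofReal_mul]
    exact mul_pos ht hb
  rw [mul_comm]
  exact (differentiableAt_cIncGamma k hre).hasDerivAt.comp b hlin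

lemma exists_analyticAt_hasSum_exp_mul_cIncGamma (k : ℝ) (hx : FreqSummable x)
    (hpos : ∀ i, 0 < x i) (hc : Subexp x c) {a₀ b₀ : ℂ} (hb₀ : 0 < b₀.re)
    (hab : a₀.im / 2 < b₀.re) :
    ∃ G : ℂ × ℂ → ℂ, AnalyticAt ℂ G (a₀, b₀) ∧
      (∀ᶠ p in 𝓝 (a₀, b₀), HasSum
        (fun i => c i * exp (-(I * x i / 2) * p.1) * cIncGamma k (x i * p.2)) (G p)) ∧
      HasSum (fun i => -(I * x i / 2) * c i * exp (-(I * x i / 2) * a₀) * cIncGamma k (x i * b₀))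
        (fderiv ℂ G (a₀, b₀) (1, 0)) ∧
      HasSum (fun i => c i * exp (-(I * x i / 2) * a₀) * (x i * deriv (cIncGamma k) (x i * b₀)))
        (fderiv ℂ G (a₀, b₀) (0, 1)) := by
  -- The weights `e^{∓qx}` share the decay `e^{-xb}` of `Γ(1 - k, xb)` between the two factors.
  obtain ⟨q, hq, hqb⟩ := exists_between (max_lt hb₀ hab)
  obtain ⟨hq0, haq⟩ := max_lt_iff.1 hq
  obtain ⟨p₁, hap, hpq⟩ := exists_between haq
  obtain ⟨p₂, hqp, hpb⟩ := exists_between hqb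
  have hp₂ := hq0.trans hqp
  obtain ⟨r, hr, hαr⟩ := exists_summable_norm_mul_exp_le hx hpos hc hpq
  obtain ⟨s, hs, hβs⟩ := exists_summable_norm_cIncGamma_mul_exp_le k hx hpos hp₂ hqp
    (show 0 < ‖b₀‖ + 1 by positivity)
  have hα i (a : ℂ) : HasDerivAt (fun a => c i * exp (-(I * x i / 2) * a) * Real.exp (-(q * x i)))
      (-(I * x i / 2) * c i * exp (-(I * x i / 2) * a) * Real.exp (-(q * x i))) a := by
    have hlin : HasDerivAt (fun a : ℂ => -(I * x i / 2) * a) (-(I * x i / 2)) a := by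
      simpa using (hasDerivAt_id a).const_mul (-(I * x i / 2))
    convert! (hlin.cexp.const_mul (c i)).mul_const _ using 1
    ring
  have hβ i (b : ℂ) (hb : 0 < b.re) :=
    (hasDerivAt_cIncGamma_mul k (hpos i) hb).mul_const ((Real.exp (q * x i) : ℝ) : ℂ)
  have hU : IsOpen {a : ℂ | a.im < 2 * p₁} := isOpen_lt continuous_im continuous_const
  have hW : IsOpen {b : ℂ | p₂ < b.re ∧ ‖b‖ < ‖b₀‖ + 1} :=
    (isOpen_lt continuous_const continuous_re).inter (isOpen_lt continuous_norm continuous_const)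
  have haU : a₀ ∈ {a : ℂ | a.im < 2 * p₁} := show a₀.im < 2 * p₁ by linarith
  have hbW : b₀ ∈ {b : ℂ | p₂ < b.re ∧ ‖b‖ < ‖b₀‖ + 1} := ⟨hpb, lt_add_one _⟩
  obtain ⟨G, hG, hsum, hsum₁, hsum₂⟩ := exists_analyticAt_hasSum_mul hU hW hr hs
    (fun i a _ => (hα i a).differentiableAt.differentiableWithinAt)
    (fun i b hb => (hβ i b (hp₂.trans hb.1)).differentiableAt.differentiableWithinAt)
    (fun i a ha => hαr i a (le_of_lt ha)) (fun i b hb => hβs i b hb.1.le hb.2.le) haU hbW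
  have hweight i (y y' : ℂ) :
      y * Real.exp (-(q * x i)) * (y' * Real.exp (q * x i)) = y * y' := by
    rw [mul_mul_mul_comm, ← ofReal_mul, ← Real.exp_add, neg_add_cancel, Real.exp_zero, ofReal_one,
      mul_one]
  simp only [(hα _ a₀).deriv, (hβ _ b₀ hb₀).deriv, hweight] at hsum hsum₁ hsum₂
  refine ⟨G, hG, ?_, hsum₁, hsum₂⟩
  filter_upwards [(hU.prod hW).mem_nhds ⟨haU, hbW⟩] with p hp using hsum p.1 hp.1 p.2 hp.2

lemma exp_neg_mul_exp_neg_mul_im (t : ℝ) (z : ℂ) :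
    exp (-(I * t / 2) * z) * exp (-(t * z.im)) = exp (I * ((1 / 2 * t : ℝ) : ℂ) * -conj z) := by
  rw [← exp_add]
  congr 1
  have hconj := sub_conj z
  push_cast at hconj ⊢
  linear_combination (-(I * t / 2)) * hconj - (t : ℂ) * z.im * I_sq

lemma exists_analyticAt_nonholSeries (k : ℝ) (hx : FreqSummable x) (hpos : ∀ i, 0 < x i)
    (hc : Subexp x c) {z : ℂ} (hz : 0 < z.im) :
    ∃ G : ℂ × ℂ → ℂ, AnalyticAt ℂ G (z, z.im) ∧
      (∀ᶠ w in 𝓝 z, HasSum (fun i => c i * (incGamma (1 - k) (x i * w.im) : ℂ) *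
        exp (-(I * x i / 2) * w)) (G (w, w.im))) ∧
      fderiv ℂ G (z, z.im) (1, 0) = nonholSeries k x (fun i => -(I * x i / 2) * c i) z ∧
      I / 2 * fderiv ℂ G (z, z.im) (0, 1) =
        ((z.im ^ (-k) : ℝ) : ℂ) * shadowSeries k x c (-conj z) := by
  have hval i {y : ℝ} (hy : 0 < y) : cIncGamma k (x i * y) = incGamma (1 - k) (x i * y) := by
    rw [← ofReal_mul, cIncGamma_ofReal k (mul_pos (hpos i) hy)]
  obtain ⟨G, hG, hsum, hsum₁, hsum₂⟩ := exists_analyticAt_hasSum_exp_mul_cIncGamma k hx hpos hc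
    (a₀ := z) (b₀ := z.im) (by simpa using hz) (by simpa using half_lt_self hz)
  refine ⟨G, hG, ?_, hsum₁.tsum_eq.symm.trans (tsum_congr fun i => ?_), ?_⟩
  · have hgraph : ContinuousAt (fun w : ℂ => (w, (w.im : ℂ))) z := by fun_prop
    filter_upwards [hgraph.eventually hsum, continuous_im.continuousAt.eventually (Ioi_mem_nhds hz)]
      with w hw hw0
    simpa only [hval _ hw0, mul_right_comm] using hw
  · rw [hval i hz]
    ring
  · rw [shadowSeries, holSeries, ← tsum_mul_left, ← hsum₂.tsum_eq, ← tsum_mul_left]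
    refine tsum_congr fun i => ?_
    rw [← ofReal_mul, deriv_cIncGamma_ofReal k (mul_pos (hpos i) hz),
      Real.mul_rpow (hpos i).le hz.le, sub_eq_add_neg 1 k, Real.rpow_add (hpos i), Real.rpow_one,
      ← exp_neg_mul_exp_neg_mul_im]
    push_cast
    ring

end Series

/-! ### Functions with a shadow, and their behaviour under inversion -/

section Shadow

variable {V : Type*} [NormedAddCommGroup V] [NormedSpace ℂ V] {k : ℝ} {M : V →L[ℂ] V}
  {F G H K : ℂ → V} {z : ℂ}

/-- The value of `∂/∂τ̄` read off from a real differential `L`. -/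
def barPart : (ℂ →L[ℝ] V) →ₗ[ℂ] V where
  toFun L := (1 / 2 : ℂ) • (L 1 + I • L I)
  map_add' L L' := by
    simp only [add_apply]
    module
  map_smul' a L := by
    simp only [smul_apply, RingHom.id_apply]
    module

lemma barPart_apply (L : ℂ →L[ℝ] V) : barPart L = (1 / 2 : ℂ) • (L 1 + I • L I) := rfl

lemma apply_eq_re_smul_add_im_smul (L : ℂ →L[ℝ] V) (a : ℂ) :
    L a = (a.re : ℂ) • L 1 + (a.im : ℂ) • L I := by
  conv_lhs => rw [show a = a.re • (1 : ℂ) + a.im • I by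
    rw [real_smul, real_smul, mul_one, re_add_im]]
  rw [map_add, map_smul, map_smul, coe_smul, coe_smul]

lemma barPart_restrictScalars (L : ℂ →L[ℂ] V) : barPart (L.restrictScalars ℝ) = 0 := by
  have hI : L I = I • L 1 := by rw [← map_smul, smul_eq_mul, mul_one]
  rw [barPart_apply, ContinuousLinearMap.coe_restrictScalars', hI, smul_smul, I_mul_I, neg_one_smul,
    add_neg_cancel, smul_zero]

lemma barPart_comp_restrictScalars (L : ℂ →L[ℝ] V) (A : ℂ →L[ℂ] ℂ) :
    barPart (L ∘L A.restrictScalars ℝ) = conj (A 1) • barPart L := by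
  have hI : A I = I * A 1 := by rw [← smul_eq_mul, ← map_smul, smul_eq_mul, mul_one]
  have hconj : conj (A 1) = ((A 1).re : ℂ) - (A 1).im * I := by
    apply Complex.ext <;> simp
  simp only [barPart_apply, ContinuousLinearMap.comp_apply,
    ContinuousLinearMap.coe_restrictScalars', hI, hconj]
  rw [apply_eq_re_smul_add_im_smul L (A 1), apply_eq_re_smul_add_im_smul L (I * A 1)]
  simp only [I_mul_re, I_mul_im, ofReal_neg]
  match_scalars
  · ring
  · linear_combination (1 / 2 : ℂ) * ((A 1).im : ℂ) * I_sq

lemma barPart_restrictScalars_comp (M : V →L[ℂ] V) (L : ℂ →L[ℝ] V) :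
    barPart (M.restrictScalars ℝ ∘L L) = M (barPart L) := by
  simp [barPart_apply]

lemma differentiableAt_complex_of_barPart_eq_zero (hF : DifferentiableAt ℝ F z)
    (hbar : barPart (fderiv ℝ F z) = 0) : DifferentiableAt ℂ F z := by
  refine differentiableAt_complex_iff_differentiableAt_real.2 ⟨hF, ?_⟩
  rw [barPart_apply, smul_eq_zero_iff_right (by norm_num)] at hbar
  rw [eq_neg_of_add_eq_zero_left hbar, smul_neg, smul_smul, I_mul_I, neg_one_smul, neg_neg]

lemma eq_zero_of_eq_zero_on_imaginary_axis [CompleteSpace V]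
    (hF : ∀ z : ℂ, 0 < z.im → DifferentiableAt ℂ F z)
    (hzero : ∀ y : ℝ, 0 < y → F (y * I) = 0) (hz : 0 < z.im) : F z = 0 := by
  have hopen : IsOpen {z : ℂ | 0 < z.im} := isOpen_lt continuous_const continuous_im
  have hanalytic : AnalyticOnNhd ℂ F {z : ℂ | 0 < z.im} :=
    DifferentiableOn.analyticOnNhd (fun w hw => (hF w hw).differentiableWithinAt) hopen
  refine hanalytic.eqOn_zero_of_preconnected_of_frequently_eq_zero
    (convex_halfSpace_im_gt 0).isPreconnected (z₀ := I) (by simp) ?_ hz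
  have haxis : Tendsto (fun y : ℝ => (y : ℂ) * I) (𝓝[≠] 1) (𝓝[≠] I) := by
    refine tendsto_nhdsWithin_iff.2 ⟨?_, ?_⟩
    · have hcont : ContinuousAt (fun y : ℝ => (y : ℂ) * I) 1 := by fun_prop
      simpa using hcont.tendsto.mono_left nhdsWithin_le_nhds
    · filter_upwards [self_mem_nhdsWithin] with y (hy : y ≠ 1) (h : (y : ℂ) * I = I)
      exact hy (by simpa using congrArg im h)
  refine haxis.frequently (Eventually.frequently ?_)
  exact (eventually_nhdsWithin_of_eventually_nhds (Ioi_mem_nhds one_pos)).mono hzero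

lemma fderiv_apply_I_eq_zero_of_eq_zero_on_imaginary_axis
    (hzero : ∀ y : ℝ, 0 < y → F (y * I) = 0) {y : ℝ} (hy : 0 < y)
    (hF : DifferentiableAt ℝ F (y * I)) : fderiv ℝ F (y * I) I = 0 := by
  have haxis : HasDerivAt (fun t : ℝ => (t : ℂ) * I) I y := by
    simpa using (ofRealCLM.hasDerivAt (x := y)).mul_const I
  refine (hF.hasFDerivAt.comp_hasDerivAt y haxis).unique
    ((hasDerivAt_const y (0 : V)).congr_of_eventuallyEq ?_)
  filter_upwards [Ioi_mem_nhds hy] with t ht using hzero t ht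

lemma ne_zero_of_im_pos (hz : 0 < z.im) : z ≠ 0 := by
  rintro rfl
  exact hz.ne rfl

lemma im_neg_inv (z : ℂ) : (-z⁻¹).im = z.im / normSq z := by
  rw [neg_im, inv_im, neg_div, neg_neg]

lemma im_neg_inv_pos (hz : 0 < z.im) : 0 < (-z⁻¹).im := by
  rw [im_neg_inv]
  exact div_pos hz (normSq_pos.2 (ne_zero_of_im_pos hz))

lemma normSq_rpow_eq_cpow_mul (hz : 0 < z.im) (k : ℝ) :
    ((normSq z ^ k : ℝ) : ℂ) = z ^ (k : ℂ) * (conj z) ^ (k : ℂ) := by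
  have harg : z.arg ≠ Real.pi := fun h => hz.ne' (arg_eq_pi_iff.1 h).2
  rw [conj_cpow _ _ harg, conj_ofReal, mul_conj, normSq_eq_norm_sq, normSq_eq_norm_sq,
    norm_cpow_of_ne_zero (ne_zero_of_im_pos hz), ofReal_re, ofReal_im, mul_zero, Real.exp_zero,
    div_one, ← Real.rpow_natCast, ← Real.rpow_natCast, ← Real.rpow_mul (norm_nonneg _),
    ← Real.rpow_mul (norm_nonneg _), mul_comm]

/-- `H` is the weight `k` shadow of `F` on the upper half plane: `H` is holomorphic and
`∂F/∂τ̄ = v^{-k} H(-τ̄)` with `v = im τ`. -/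
structure HasShadow (k : ℝ) (F H : ℂ → V) : Prop where
  differentiableAt : ∀ z : ℂ, 0 < z.im → DifferentiableAt ℝ F z
  differentiableAt_shadow : ∀ z : ℂ, 0 < z.im → DifferentiableAt ℂ H z
  barPart_fderiv : ∀ z : ℂ, 0 < z.im →
    barPart (fderiv ℝ F z) = ((z.im ^ (-k) : ℝ) : ℂ) • H (-conj z)

lemma hasShadow_zero (k : ℝ) (hF : ∀ z : ℂ, 0 < z.im → DifferentiableAt ℂ F z) :
    HasShadow k F 0 where
  differentiableAt z hz := (hF z hz).restrictScalars ℝ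
  differentiableAt_shadow z _ := differentiableAt_const 0
  barPart_fderiv z hz := by
    rw [(hF z hz).fderiv_restrictScalars ℝ, barPart_restrictScalars, Pi.zero_apply, smul_zero]

lemma HasShadow.add (hF : HasShadow k F H) (hG : HasShadow k G K) :
    HasShadow k (F + G) (H + K) where
  differentiableAt z hz := (hF.differentiableAt z hz).add (hG.differentiableAt z hz)
  differentiableAt_shadow z hz :=
    (hF.differentiableAt_shadow z hz).add (hG.differentiableAt_shadow z hz)
  barPart_fderiv z hz := by
    rw [fderiv_add (hF.differentiableAt z hz) (hG.differentiableAt z hz), map_add,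
      hF.barPart_fderiv z hz, hG.barPart_fderiv z hz, Pi.add_apply, smul_add]

lemma HasShadow.congr (hF : HasShadow k F H) (h : ∀ z : ℂ, 0 < z.im → G z = F z) :
    HasShadow k G H := by
  have heq (z : ℂ) (hz : 0 < z.im) : G =ᶠ[𝓝 z] F := by
    filter_upwards [(isOpen_lt continuous_const continuous_im).mem_nhds hz] with w hw using h w hw
  exact ⟨fun z hz => (hF.differentiableAt z hz).congr_of_eventuallyEq (heq z hz),
    hF.differentiableAt_shadow, fun z hz => by rw [(heq z hz).fderiv_eq, hF.barPart_fderiv z hz]⟩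

lemma HasShadow.pi {ι : Type*} [Fintype ι] {f h : ι → ℂ → ℂ}
    (hf : ∀ j, HasShadow k (f j) (h j)) :
    HasShadow k (fun z j => f j z) (fun z j => h j z) where
  differentiableAt z hz := differentiableAt_pi.2 fun j => (hf j).differentiableAt z hz
  differentiableAt_shadow z hz := differentiableAt_pi.2 fun j => (hf j).differentiableAt_shadow z hz
  barPart_fderiv z hz := by
    ext j
    rw [fderiv_pi fun j => (hf j).differentiableAt z hz]
    exact (hf j).barPart_fderiv z hz

/-- The operator `δ_k F = τ ∂F/∂u + (k/2) F`, where `τ = u + iv`. -/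
def delta (k : ℝ) (F : ℂ → V) (z : ℂ) : V := z • fderiv ℝ F z 1 + ((k : ℂ) / 2) • F z

/-- The difference of the two sides of the functional equation `F(-1/z) = z^k M F(z)`. -/
def inversionDefect (k : ℝ) (M : V →L[ℂ] V) (F : ℂ → V) (z : ℂ) : V :=
  F (-z⁻¹) - z ^ (k : ℂ) • M (F z)

/-- The difference of the two sides of the functional equation which the shadow `H` inherits from
the weight `k` functional equation of a function with that shadow. -/
def shadowDefect (k : ℝ) (M : V →L[ℂ] V) (H : ℂ → V) (w : ℂ) : V :=
  ((-w) ^ (k : ℂ) * (w ^ 2)⁻¹) • H (-w⁻¹) - M (H w)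

lemma hasFDerivAt_inversionDefect (k : ℝ) (M : V →L[ℂ] V)
    (hF : ∀ z : ℂ, 0 < z.im → DifferentiableAt ℝ F z) (hz : 0 < z.im) :
    HasFDerivAt (inversionDefect k M F)
      (fderiv ℝ F (-z⁻¹) ∘L (ContinuousLinearMap.toSpanSingleton ℂ (z ^ 2)⁻¹).restrictScalars ℝ -
        (z ^ (k : ℂ) • (M.restrictScalars ℝ ∘L fderiv ℝ F z) +
          (ContinuousLinearMap.toSpanSingleton ℂ
            ((k * z ^ ((k : ℂ) - 1)) • M (F z))).restrictScalars ℝ)) z := by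
  have hinv : HasDerivAt (fun z : ℂ => -z⁻¹) (z ^ 2)⁻¹ z := by
    simpa using! (hasDerivAt_inv (ne_zero_of_im_pos hz)).neg
  have hpow : HasDerivAt (fun z : ℂ => z ^ (k : ℂ)) (k * z ^ ((k : ℂ) - 1)) z := by
    simpa using (hasDerivAt_id z).cpow_const (c := (k : ℂ)) (Or.inr hz.ne')
  have hcomp := (hF _ (im_neg_inv_pos hz)).hasFDerivAt.comp z (hinv.hasFDerivAt.restrictScalars ℝ)
  have hsmul := (hpow.hasFDerivAt.restrictScalars ℝ).smul
    ((M.restrictScalars ℝ).hasFDerivAt.comp z (hF z hz).hasFDerivAt)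
  refine (hcomp.sub hsmul).congr_fderiv ?_
  ext
  simp [mul_smul]

lemma fderiv_inversionDefect_one_eq_zero (hF : ∀ z : ℂ, 0 < z.im → DifferentiableAt ℝ F z)
    {y : ℝ} (hy : 0 < y) (hzero : inversionDefect k M F (y * I) = 0)
    (hdelta : delta k F (-(y * I)⁻¹) = -(y * I) ^ (k : ℂ) • M (delta k F (y * I))) :
    fderiv ℝ (inversionDefect k M F) (y * I) 1 = 0 := by
  have him : 0 < ((y : ℂ) * I).im := by simpa using hy
  have hy0 := ne_zero_of_im_pos him
  have hreal : (((y : ℂ) * I) ^ 2)⁻¹ = (-(y ^ 2)⁻¹ : ℝ) • (1 : ℂ) := by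
    rw [mul_pow, I_sq, mul_neg_one, inv_neg, real_smul]
    push_cast
    ring
  have hmap (L : ℂ →L[ℝ] V) : L (((y : ℂ) * I) ^ 2)⁻¹ = (((y : ℂ) * I) ^ 2)⁻¹ • L 1 := by
    rw [hreal, map_smul, smul_assoc, one_smul]
  rw [inversionDefect, sub_eq_zero] at hzero
  rw [(hasFDerivAt_inversionDefect k M hF him).fderiv]
  simp only [delta, hzero, map_add, map_smul] at hdelta
  simp only [sub_apply, ContinuousLinearMap.comp_apply, add_apply, smul_apply, hmap,
    ContinuousLinearMap.coe_restrictScalars', ContinuousLinearMap.toSpanSingleton_apply, one_smul,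
    cpow_sub _ _ hy0, cpow_one]
  generalize (y : ℂ) * I = z at *
  linear_combination (norm := (match_scalars <;> field_simp <;> ring)) (-z⁻¹) • hdelta

lemma HasShadow.barPart_fderiv_inversionDefect (hF : HasShadow k F H) (M : V →L[ℂ] V)
    (hz : 0 < z.im) : barPart (fderiv ℝ (inversionDefect k M F) z) =
      (((z.im ^ (-k) : ℝ) : ℂ) * z ^ (k : ℂ)) • shadowDefect k M H (-conj z) := by
  rw [(hasFDerivAt_inversionDefect k M hF.differentiableAt hz).fderiv, map_sub, map_add, map_smul,
    barPart_comp_restrictScalars, barPart_restrictScalars_comp, barPart_restrictScalars, add_zero,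
    ContinuousLinearMap.toSpanSingleton_apply, one_smul, hF.barPart_fderiv _ (im_neg_inv_pos hz),
    hF.barPart_fderiv z hz, im_neg_inv, Real.div_rpow hz.le (normSq_nonneg _),
    Real.rpow_neg (normSq_nonneg z), div_inv_eq_mul, ofReal_mul, normSq_rpow_eq_cpow_mul hz]
  simp only [shadowDefect, map_neg, map_inv₀, map_pow, neg_neg, inv_neg, neg_sq, map_smul]
  module

lemma differentiableAt_shadowDefect (k : ℝ) (M : V →L[ℂ] V)
    (hH : ∀ z : ℂ, 0 < z.im → DifferentiableAt ℂ H z) (hz : 0 < z.im) :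
    DifferentiableAt ℂ (shadowDefect k M H) z := by
  have hz0 := ne_zero_of_im_pos hz
  have hpow : DifferentiableAt ℂ (fun w : ℂ => (-w) ^ (k : ℂ)) z :=
    differentiableAt_id.neg.cpow_const (Or.inr (by simpa using hz.ne'))
  have hinv : DifferentiableAt ℂ (fun w : ℂ => (w ^ 2)⁻¹) z :=
    (differentiableAt_id.pow 2).inv (pow_ne_zero 2 hz0)
  have hcomp : DifferentiableAt ℂ (fun w : ℂ => H (-w⁻¹)) z :=
    (hH _ (im_neg_inv_pos hz)).comp z (differentiableAt_id.inv hz0).neg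
  exact ((hpow.mul hinv).smul hcomp).sub (M.differentiableAt.comp z (hH z hz))

lemma HasShadow.shadowDefect_eq_zero [CompleteSpace V] (hF : HasShadow k F H)
    (hzero : ∀ y : ℝ, 0 < y → inversionDefect k M F (y * I) = 0)
    (hdelta : ∀ y : ℝ, 0 < y →
      delta k F (-(y * I)⁻¹) = -(y * I) ^ (k : ℂ) • M (delta k F (y * I)))
    (hz : 0 < z.im) : shadowDefect k M H z = 0 := by
  refine eq_zero_of_eq_zero_on_imaginary_axis
    (fun w hw => differentiableAt_shadowDefect k M hF.differentiableAt_shadow hw)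
    (fun y hy => ?_) hz
  have him : 0 < ((y : ℂ) * I).im := by simpa using hy
  have hbar := hF.barPart_fderiv_inversionDefect M him
  rw [barPart_apply, fderiv_inversionDefect_one_eq_zero hF.differentiableAt hy (hzero y hy)
    (hdelta y hy), fderiv_apply_I_eq_zero_of_eq_zero_on_imaginary_axis hzero hy
    (hasFDerivAt_inversionDefect k M hF.differentiableAt him).differentiableAt, smul_zero, add_zero,
    smul_zero, eq_comm, smul_eq_zero_iff_right (mul_ne_zero _ _)] at hbar
  · simpa using hbar
  · exact ofReal_ne_zero.2 (Real.rpow_pos_of_pos him _).ne'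
  · exact fun h => ne_zero_of_im_pos him (cpow_eq_zero_iff _ _ |>.1 h).1

theorem HasShadow.inversion_formula [CompleteSpace V] (hF : HasShadow k F H)
    (haxis : ∀ y : ℝ, 0 < y → F (-(y * I)⁻¹) = (y * I) ^ (k : ℂ) • M (F (y * I)))
    (hdelta : ∀ y : ℝ, 0 < y →
      delta k F (-(y * I)⁻¹) = -(y * I) ^ (k : ℂ) • M (delta k F (y * I)))
    (hz : 0 < z.im) : F (-z⁻¹) = z ^ (k : ℂ) • M (F z) := by
  have hzero (y : ℝ) (hy : 0 < y) : inversionDefect k M F (y * I) = 0 := sub_eq_zero.2 (haxis y hy)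
  have hholo (w : ℂ) (hw : 0 < w.im) : DifferentiableAt ℂ (inversionDefect k M F) w := by
    refine differentiableAt_complex_of_barPart_eq_zero
      (hasFDerivAt_inversionDefect k M hF.differentiableAt hw).differentiableAt ?_
    rw [hF.barPart_fderiv_inversionDefect M hw,
      hF.shadowDefect_eq_zero hzero hdelta (by simpa using hw), smul_zero]
  exact sub_eq_zero.1 (eq_zero_of_eq_zero_on_imaginary_axis hholo hzero hz)

lemma fderiv_im_rpow_smul_neg_conj (p : ℝ) (hH : DifferentiableAt ℂ H (-conj z)) (hz : 0 < z.im)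
    (w : ℂ) : fderiv ℝ (fun w : ℂ => ((w.im ^ p : ℝ) : ℂ) • H (-conj w)) z w =
      (((z.im ^ p : ℝ) : ℂ) * -conj w) • deriv H (-conj z) +
        ((p * z.im ^ (p - 1) * w.im : ℝ) : ℂ) • H (-conj z) := by
  have hpow : HasFDerivAt (fun w : ℂ => ((w.im ^ p : ℝ) : ℂ))
      (ofRealCLM ∘L ((p * z.im ^ (p - 1)) • imCLM)) z :=
    ofRealCLM.hasFDerivAt.comp z
      ((Real.hasDerivAt_rpow_const (Or.inl hz.ne')).comp_hasFDerivAt z imCLM.hasFDerivAt)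
  have hconj : HasFDerivAt (fun w : ℂ => -conj w) (-(conjCLE : ℂ →L[ℝ] ℂ)) z :=
    conjCLE.hasFDerivAt.neg
  have hcomp := (hH.hasDerivAt.hasFDerivAt.restrictScalars ℝ).comp z hconj
  rw [mul_smul]
  exact congrArg (· w) (hpow.smul hcomp).fderiv

theorem HasShadow.laplacian_eq_zero {m : ℕ} {F H : ℂ → Fin m → ℂ} (hF : HasShadow k F H)
    (hz : 0 < z.im) : laplacian k F z = 0 := by
  have hbar : dTauBar F =ᶠ[𝓝 z] fun w => ((w.im ^ (-k) : ℝ) : ℂ) • H (-conj w) := by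
    filter_upwards [(isOpen_lt continuous_const continuous_im).mem_nhds hz] with w hw
    exact hF.barPart_fderiv w hw
  have hpow : ((z.im ^ (-k) : ℝ) : ℂ) = ((z.im ^ (-k - 1) : ℝ) : ℂ) * z.im := by
    rw [← ofReal_mul, ← Real.rpow_add_one hz.ne', sub_add_cancel]
  have hfderiv := fderiv_im_rpow_smul_neg_conj (-k)
    (hF.differentiableAt_shadow (-conj z) (by simpa using hz)) hz
  rw [laplacian, dTau, hbar.fderiv_eq, hbar.eq_of_nhds, hfderiv, hfderiv, hpow]
  simp only [map_one, conj_I, one_im, I_im, mul_zero, mul_one, neg_neg]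
  push_cast
  match_scalars
  · linear_combination (2 : ℂ) * (z.im : ℂ) ^ 3 * ((z.im ^ (-k - 1) : ℝ) : ℂ) * I_sq
  · ring

end Shadow

section SeriesShadow

variable {ι : Type*} {k : ℝ} {x : ι → ℝ} {c : ι → ℂ} {z : ℂ}

lemma fderiv_holSeries_one (hx : FreqSummable x) (hc : Subexp x c) (hz : 0 < z.im) :
    fderiv ℝ (holSeries x c) z 1 = holSeries x (fun i => I * x i * c i) z := by
  rw [((hasDerivAt_holSeries hx hc hz).hasFDerivAt.restrictScalars ℝ).fderiv]
  simp

lemma analyticAt_holSeries (hx : FreqSummable x) (hc : Subexp x c) (hz : 0 < z.im) :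
    AnalyticAt ℂ (holSeries x c) z := by
  refine analyticAt_iff_eventually_differentiableAt.2 ?_
  filter_upwards [(isOpen_lt continuous_const continuous_im).mem_nhds hz] with w hw
  exact (hasDerivAt_holSeries hx hc hw).differentiableAt

lemma hasShadow_holSeries (k : ℝ) (hx : FreqSummable x) (hc : Subexp x c) :
    HasShadow k (holSeries x c) 0 :=
  hasShadow_zero k fun _ hz => (hasDerivAt_holSeries hx hc hz).differentiableAt

lemma summable_nonholSeries (k : ℝ) (hx : FreqSummable x) (hpos : ∀ i, 0 < x i) (hc : Subexp x c)
    (hz : 0 < z.im) :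
    Summable fun i => c i * (incGamma (1 - k) (x i * z.im) : ℂ) * exp (-(I * x i / 2) * z) := by
  obtain ⟨G, -, hG, -⟩ := exists_analyticAt_nonholSeries k hx hpos hc hz
  exact hG.self_of_nhds.summable

lemma exists_hasFDerivAt_nonholSeries (k : ℝ) (hx : FreqSummable x) (hpos : ∀ i, 0 < x i)
    (hc : Subexp x c) (hz : 0 < z.im) :
    AnalyticAt ℝ (nonholSeries k x c) z ∧
      ∃ L : ℂ →L[ℝ] ℂ, HasFDerivAt (nonholSeries k x c) L z ∧
        L 1 = nonholSeries k x (fun i => -(I * x i / 2) * c i) z ∧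
        barPart L = ((z.im ^ (-k) : ℝ) : ℂ) * shadowSeries k x c (-conj z) := by
  obtain ⟨G, hG, hsum, hG₁, hG₂⟩ := exists_analyticAt_nonholSeries k hx hpos hc hz
  let graph : ℂ →L[ℝ] ℂ × ℂ := (ContinuousLinearMap.id ℝ ℂ).prod (ofRealCLM ∘L imCLM)
  have heq : nonholSeries k x c =ᶠ[𝓝 z] G ∘ graph := hsum.mono fun w hw => hw.tsum_eq
  have hGreal : AnalyticAt ℝ G (graph z) := hG.restrictScalars
  have hGderiv : HasFDerivAt G (fderiv ℂ G (z, z.im)) (graph z) :=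
    hG.differentiableAt.hasFDerivAt
  refine ⟨(hGreal.comp (graph.analyticAt z)).congr heq.symm, _,
    ((hGderiv.restrictScalars ℝ).comp z graph.hasFDerivAt).congr_of_eventuallyEq heq, ?_, ?_⟩
  · simpa [graph] using hG₁
  · have hI : ((I, 1) : ℂ × ℂ) = I • (1, 0) + (0, 1) := by simp
    rw [← hG₂, barPart_apply]
    simp only [graph, ContinuousLinearMap.comp_apply, ContinuousLinearMap.coe_restrictScalars',
      ContinuousLinearMap.prod_apply, ContinuousLinearMap.id_apply, imCLM_apply, ofRealCLM_apply,
      one_im, I_im, ofReal_zero, ofReal_one, hI, map_add, map_smul, smul_eq_mul]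
    linear_combination (1 / 2 * fderiv ℂ G (z, z.im) (1, 0)) * I_sq

lemma analyticAt_nonholSeries (k : ℝ) (hx : FreqSummable x) (hpos : ∀ i, 0 < x i)
    (hc : Subexp x c) (hz : 0 < z.im) : AnalyticAt ℝ (nonholSeries k x c) z :=
  (exists_hasFDerivAt_nonholSeries k hx hpos hc hz).1

lemma fderiv_nonholSeries_one (k : ℝ) (hx : FreqSummable x) (hpos : ∀ i, 0 < x i)
    (hc : Subexp x c) (hz : 0 < z.im) :
    fderiv ℝ (nonholSeries k x c) z 1 = nonholSeries k x (fun i => -(I * x i / 2) * c i) z := by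
  obtain ⟨-, L, hL, hL1, -⟩ := exists_hasFDerivAt_nonholSeries k hx hpos hc hz
  rw [hL.fderiv, hL1]

lemma hasShadow_nonholSeries (k : ℝ) (hx : FreqSummable x) (hpos : ∀ i, 0 < x i)
    (hc : Subexp x c) : HasShadow k (nonholSeries k x c) (shadowSeries k x c) where
  differentiableAt z hz := (analyticAt_nonholSeries k hx hpos hc hz).differentiableAt
  differentiableAt_shadow z hz := (hasDerivAt_holSeries (hx.const_mul one_half_pos)
    ((((subexp_ofReal_rpow hx hpos (1 - k)).mul hc).const_mul (-(I / 2))).comp_const_mul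
      one_half_pos) hz).differentiableAt
  barPart_fderiv z hz := by
    obtain ⟨-, L, hL, -, hbar⟩ := exists_hasFDerivAt_nonholSeries k hx hpos hc hz
    rw [hL.fderiv, hbar, smul_eq_mul]

lemma exists_summable_norm_nonholSeries_le (k : ℝ) (hx : FreqSummable x) (hpos : ∀ i, 0 < x i)
    (hc : Subexp x c) {a : ℝ} (ha : 0 < a) :
    ∃ u : ι → ℝ, Summable u ∧ ∀ i (z : ℂ), a ≤ z.im →
      ‖c i * (incGamma (1 - k) (x i * z.im) : ℂ) * exp (-(I * x i / 2) * z)‖ ≤ u i := by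
  obtain ⟨x₀, hx₀, hle⟩ := hx.exists_pos_forall_le hpos
  obtain ⟨C, hC, hΓ⟩ := exists_norm_cIncGamma_le k (mul_pos hx₀ ha) (show (0 : ℝ) < 1 / 4 by simp)
  obtain ⟨K, hK, hcK⟩ := hc (a / 8) (by positivity)
  refine ⟨fun i => K * C * Real.exp (-(a / 8) * x i), (hx _ (by positivity)).mul_left _,
    fun i z hz => ?_⟩
  have hxz : 0 < x i * z.im := mul_pos (hpos i) (ha.trans_le hz)
  have hΓi := hΓ ((x i * z.im : ℝ) : ℂ)
    (by rw [ofReal_re]; exact mul_le_mul (hle i) hz ha.le (hpos i).le)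
  rw [cIncGamma_ofReal k hxz, norm_real (x i * z.im), Real.norm_of_nonneg hxz.le, ofReal_re] at hΓi
  have hexp : ‖exp (-(I * x i / 2) * z)‖ = Real.exp (x i * z.im / 2) := by
    rw [show -(I * x i / 2) * z = I * ((-(x i / 2) : ℝ) : ℂ) * z by push_cast; ring,
      norm_exp_I_mul_ofReal_mul]
    ring_nf
  have hxa := mul_le_mul_of_nonneg_left hz (hpos i).le
  rw [norm_mul, norm_mul, hexp]
  calc _ ≤ K * Real.exp (a / 8 * x i) *
        (C * Real.exp (1 / 4 * (x i * z.im) - x i * z.im)) * Real.exp (x i * z.im / 2) := by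
        gcongr
        exact hcK i
    _ = K * C * Real.exp (a / 8 * x i - x i * z.im / 4) := by
        rw [mul_mul_mul_comm, mul_assoc, ← Real.exp_add, ← Real.exp_add]
        ring_nf
    _ ≤ K * C * Real.exp (-(a / 8) * x i) := by
        gcongr
        linarith

end SeriesShadow

/-! ### Integration against test functions -/

section TestFunctions

variable {φ : ℝ → ℂ}

/-- Functions integrable on `(0, ∞)` that vanish there outside a compact interval. Unlike piecewise
smoothness, this property is preserved by multiplication by functions continuous on `(0, ∞)`. -/
structure IsCompactIntegrable (φ : ℝ → ℂ) : Prop where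
  integrableOn : IntegrableOn φ (Ioi 0)
  exists_mem_Icc : ∃ a b : ℝ, 0 < a ∧ a ≤ b ∧ ∀ y, 0 < y → φ y ≠ 0 → y ∈ Icc a b

lemma IsTestFunction.locallyIntegrableOn (hφ : IsTestFunction φ) :
    LocallyIntegrableOn φ (Ioi 0) := by
  intro x hx
  obtain ⟨ε, hε, g, h, hg, hh, hgl, hhr, -⟩ := hφ.piecewiseSmooth x hx
  obtain ⟨δ, hδ, hδε⟩ := exists_between hε
  have hint : ∀ q : ℝ → ℂ, ContDiffOn ℝ ∞ q (Ioo (x - ε) (x + ε)) →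
      IntegrableOn q (Icc (x - δ) (x + δ)) := fun q hq =>
    (hq.continuousOn.mono (Icc_subset_Ioo (by linarith) (by linarith))).integrableOn_Icc
  have hleft : IntegrableOn φ (Ioo (x - δ) x) :=
    ((hint g hg).mono_set fun y hy => ⟨hy.1.le, by linarith [hy.2]⟩).congr_fun
      (fun y hy => (hgl y ⟨by linarith [hy.1], hy.2⟩).symm) measurableSet_Ioo
  have hright : IntegrableOn φ (Ioo x (x + δ)) :=
    ((hint h hh).mono_set fun y hy => ⟨by linarith [hy.1], hy.2.le⟩).congr_fun
      (fun y hy => (hhr y ⟨hy.1, by linarith [hy.2]⟩).symm) measurableSet_Ioo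
  have hpoint : IntegrableOn φ {x} := integrableOn_singleton (hx := by simp)
  refine ⟨Ioo (x - δ) (x + δ), mem_nhdsWithin_of_mem_nhds
    (Ioo_mem_nhds (by linarith) (by linarith)),
    ((hleft.union hpoint).union hright).mono_set fun y hy => ?_⟩
  rcases lt_trichotomy y x with hyx | hyx | hyx
  · exact Or.inl (Or.inl ⟨hy.1, hyx⟩)
  · exact Or.inl (Or.inr hyx)
  · exact Or.inr ⟨hyx, hy.2⟩

lemma IsTestFunction.support_subset_closure_interior (hφ : IsTestFunction φ) :
    Function.support φ ⊆ closure (interior (Function.support φ)) := by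
  intro x hφx
  obtain ⟨ε, hε, g, h, hg, hh, hgl, hhr, hval⟩ :=
    hφ.piecewiseSmooth x (hφ.support_pos (subset_tsupport φ hφx))
  have hnhds : Ioo (x - ε) (x + ε) ∈ 𝓝 x := Ioo_mem_nhds (by linarith) (by linarith)
  have hne : ∀ q : ℝ → ℂ, ContDiffOn ℝ ∞ q (Ioo (x - ε) (x + ε)) → φ x = q x →
      ∀ᶠ y in 𝓝 x, q y ≠ 0 := fun q hq hqx =>
    (hq.continuousOn.continuousAt hnhds).eventually_ne (hqx ▸ hφx)
  rcases hval with hval | hval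
  · have hev : ∀ᶠ y in 𝓝[<] x, y ∈ Function.support φ := by
      filter_upwards [nhdsWithin_le_nhds (hne g hg hval),
        Ioo_mem_nhdsLT (show x - ε < x by linarith)] with y hy hmem
      rwa [Function.mem_support, hgl y hmem]
    obtain ⟨l, hl, hsub⟩ := mem_nhdsLT_iff_exists_Ioo_subset.1 hev
    refine closure_mono (interior_maximal hsub isOpen_Ioo) ?_
    rw [closure_Ioo hl.ne]
    exact right_mem_Icc.2 hl.le
  · have hev : ∀ᶠ y in 𝓝[>] x, y ∈ Function.support φ := by
      filter_upwards [nhdsWithin_le_nhds (hne h hh hval),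
        Ioo_mem_nhdsGT (show x < x + ε by linarith)] with y hy hmem
      rwa [Function.mem_support, hhr y hmem]
    obtain ⟨r, hr, hsub⟩ := mem_nhdsGT_iff_exists_Ioo_subset.1 hev
    refine closure_mono (interior_maximal hsub isOpen_Ioo) ?_
    rw [closure_Ioo hr.ne]
    exact left_mem_Icc.2 hr.le

lemma IsTestFunction.isCompactIntegrable (hφ : IsTestFunction φ) : IsCompactIntegrable φ where
  integrableOn := IntegrableOn.of_forall_sdiff_eq_zero
    ((hφ.locallyIntegrableOn.mono_set hφ.support_pos).integrableOn_isCompact hφ.compactSupport)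
    measurableSet_Ioi fun _ hy => image_eq_zero_of_notMem_tsupport hy.2
  exists_mem_Icc := by
    rcases (tsupport φ).eq_empty_or_nonempty with hempty | hne
    · exact ⟨1, 1, one_pos, le_rfl, fun y _ hy =>
        (hempty ▸ subset_tsupport φ hy : y ∈ (∅ : Set ℝ)).elim⟩
    · have hcompact : IsCompact (tsupport φ) := hφ.compactSupport
      obtain ⟨a, ha, hmin⟩ := hcompact.exists_isLeast hne
      obtain ⟨b, hb, hmax⟩ := hcompact.exists_isGreatest hne
      exact ⟨a, b, hφ.support_pos ha, hmin hb, fun y _ hy =>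
        ⟨hmin (subset_tsupport φ hy), hmax (subset_tsupport φ hy)⟩⟩

namespace IsCompactIntegrable

lemma continuousOn_mul {q : ℝ → ℂ} (hφ : IsCompactIntegrable φ) (hq : ContinuousOn q (Ioi 0)) :
    IsCompactIntegrable fun y => q y * φ y := by
  obtain ⟨a, b, ha, hab, hmem⟩ := hφ.exists_mem_Icc
  have hsub : Icc a b ⊆ Ioi 0 := fun y hy => ha.trans_le hy.1
  have hmem' : ∀ y, 0 < y → q y * φ y ≠ 0 → y ∈ Icc a b := fun y hy hne =>
    hmem y hy (right_ne_zero_of_mul hne)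
  exact ⟨IntegrableOn.of_forall_sdiff_eq_zero
    ((hφ.integrableOn.mono_set hsub).continuousOn_mul (hq.mono hsub) isCompact_Icc)
    measurableSet_Ioi fun y hy => of_not_not fun hne => hy.2 (hmem' y hy.1 hne),
    a, b, ha, hab, hmem'⟩

lemma congr {ψ : ℝ → ℂ} (hφ : IsCompactIntegrable φ) (h : EqOn φ ψ (Ioi 0)) :
    IsCompactIntegrable ψ := by
  obtain ⟨a, b, ha, hab, hmem⟩ := hφ.exists_mem_Icc
  exact ⟨hφ.integrableOn.congr_fun h measurableSet_Ioi, a, b, ha, hab,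
    fun y hy hne => hmem y hy ((h hy).trans_ne hne)⟩

lemma twist (hφ : IsCompactIntegrable φ) (s : ℂ) : IsCompactIntegrable (twist φ s) := by
  have hpow : ContinuousOn (fun y : ℝ => (y : ℂ) ^ (s - 1)) (Ioi 0) := fun y (hy : 0 < y) =>
    ((continuousAt_ofReal_cpow_const y _ (Or.inr hy.ne'))).continuousWithinAt
  exact (hφ.continuousOn_mul hpow).congr fun y _ => mul_comm _ _

lemma rpow_smul_comp_inv (hφ : IsCompactIntegrable φ) :
    IsCompactIntegrable fun y : ℝ => y ^ ((-1 : ℝ) - 1) • φ (y ^ (-1 : ℝ)) := by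
  obtain ⟨a, b, ha, hab, hmem⟩ := hφ.exists_mem_Icc
  refine ⟨(integrableOn_Ioi_comp_rpow_iff' φ (by norm_num)).2 hφ.integrableOn, b⁻¹, a⁻¹,
    inv_pos.2 (ha.trans_le hab), inv_anti₀ ha hab, fun y hy hne => ?_⟩
  have hinv := hmem _ (Real.rpow_pos_of_pos hy _) (smul_ne_zero_iff.1 hne).2
  rw [Real.rpow_neg_one] at hinv
  exact ⟨inv_le_of_inv_le₀ hy hinv.2, le_inv_of_le_inv₀ ha hinv.1⟩

lemma testSlash (hφ : IsCompactIntegrable φ) (k : ℝ) (χ : SL(2, ℤ) → ℂ) :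
    IsCompactIntegrable (testSlash k χ φ) := by
  refine (hφ.rpow_smul_comp_inv.continuousOn_mul
    ((continuousOn_ofReal_rpow k).mul (continuousOn_const (c := χ ModularGroup.S)))).congr
    fun y (hy : 0 < y) => ?_
  simp only [VVMaass.testSlash, Pi.mul_apply, real_smul, Real.rpow_neg_one, one_div,
    show k - 2 = k + (-1 - 1) by ring, Real.rpow_add hy k, ofReal_mul]
  ring

end IsCompactIntegrable

lemma integral_mul_testSlash (k : ℝ) (χ : SL(2, ℤ) → ℂ) (φ g : ℝ → ℂ) :
    ∫ y in Ioi (0 : ℝ), g y * testSlash k χ φ y =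
      ∫ y in Ioi (0 : ℝ), (χ ModularGroup.S * ((y ^ (-k) : ℝ) : ℂ) * g y⁻¹) * φ y := by
  rw [← integral_comp_rpow_Ioi _ (show (-1 : ℝ) ≠ 0 by norm_num)]
  refine setIntegral_congr_fun measurableSet_Ioi fun y (hy : 0 < y) => ?_
  have hpow : ((y ^ (-1 - 1 : ℝ) : ℝ) : ℂ) * ((y ^ (-(k - 2)) : ℝ) : ℂ) =
      ((y ^ (-k) : ℝ) : ℂ) := by
    rw [← ofReal_mul, ← Real.rpow_add hy]
    ring_nf
  rw [testSlash, Real.rpow_neg_one, real_smul, one_div, inv_inv, abs_neg, abs_one, one_mul,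
    Real.inv_rpow hy.le, ← Real.rpow_neg hy.le, ← hpow]
  ring

end TestFunctions

/-! ### Laplace transforms of the series -/

section Laplace

variable {ι : Type*} [Countable ι] {x : ι → ℝ} {c : ι → ℂ} {φ : ℝ → ℂ}

lemma IsCompactIntegrable.hasSum_integral_mul {g : ι → ℝ → ℂ} (hφ : IsCompactIntegrable φ)
    (hg : ∀ i, ContinuousOn (g i) (Ioi 0))
    (hbound : ∀ a b : ℝ, 0 < a → ∃ u : ι → ℝ, Summable u ∧ ∀ i, ∀ y ∈ Icc a b, ‖g i y‖ ≤ u i) :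
    HasSum (fun i => ∫ y in Ioi (0 : ℝ), g i y * φ y)
      (∫ y in Ioi (0 : ℝ), (∑' i, g i y) * φ y) := by
  obtain ⟨a, b, ha, -, hmem⟩ := hφ.exists_mem_Icc
  obtain ⟨u, hu, hgu⟩ := hbound a b ha
  have hint : ∀ i, IntegrableOn (fun y => g i y * φ y) (Ioi 0) := fun i =>
    (hφ.continuousOn_mul (hg i)).integrableOn
  simp_rw [← tsum_mul_right]
  refine hasSum_integral_of_summable_integral_norm hint ?_
  refine Summable.of_nonneg_of_le (fun i => integral_nonneg fun y => norm_nonneg _) (fun i => ?_)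
    (hu.mul_right (∫ y in Ioi (0 : ℝ), ‖φ y‖))
  rw [← integral_const_mul]
  refine setIntegral_mono_on (hint i).norm (hφ.integrableOn.norm.const_mul _) measurableSet_Ioi
    fun y hy => ?_
  rcases eq_or_ne (φ y) 0 with hφy | hφy
  · simp [hφy]
  · rw [norm_mul]
    gcongr
    exact hgu i y (hmem y hy hφy)

lemma IsCompactIntegrable.hasSum_mul_laplace (hφ : IsCompactIntegrable φ) (hx : FreqSummable x)
    (hc : Subexp x c) :
    HasSum (fun i => c i * laplace φ (x i))
      (∫ y in Ioi (0 : ℝ), holSeries x c (y * I) * φ y) := by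
  have hterm : ∀ i, ∫ y in Ioi (0 : ℝ), c i * exp (I * x i * (y * I)) * φ y =
      c i * laplace φ (x i) := fun i => by
    rw [laplace, ← integral_const_mul]
    refine integral_congr_ae (ae_of_all _ fun y => ?_)
    have hexp : I * x i * (y * I) = -x i * y := by linear_combination (x i * y : ℂ) * I_sq
    simp only [hexp, mul_assoc]
  simp_rw [← hterm]
  refine hφ.hasSum_integral_mul (fun i => by fun_prop) fun a b ha => ?_
  rcases le_or_gt a b with hab | hab
  · obtain ⟨u, hu, hle⟩ := exists_summable_norm_holSeries_le hx hc ha hab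
    exact ⟨u, hu, fun i y hy => hle i (y * I) (by simpa using hy.1) (by simpa using hy.2)⟩
  · simpa only [Icc_eq_empty hab.not_ge] using ⟨0, summable_zero, by simp⟩

lemma integrable_uncurry_laplace_integrand (k : ℝ) {t : ℝ} (ht : 0 < t)
    (hφ : IsCompactIntegrable φ) :
    Integrable (Function.uncurry fun s y : ℝ =>
      exp (-((t / 2 * (2 * s + 1) : ℝ) : ℂ) * y) * φ y * (((1 + s) ^ (-k) : ℝ) : ℂ))
      ((volume.restrict (Ioi (0 : ℝ))).prod (volume.restrict (Ioi (0 : ℝ)))) := by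
  obtain ⟨a, b, ha, -, hmem⟩ := hφ.exists_mem_Icc
  refine ((integrableOn_exp_neg_mul_mul_one_add_rpow (-k) (mul_pos ht ha)).mul_prod
    hφ.integrableOn.norm).mono' ?_ ?_
  · have hpow : AEStronglyMeasurable (fun s : ℝ => (((1 + s) ^ (-k) : ℝ) : ℂ))
        (volume.restrict (Ioi 0)) := by
      simpa using aestronglyMeasurable_tricomi_integrand k 0
    have hexp : Continuous fun p : ℝ × ℝ =>
        exp (-((t / 2 * (2 * p.1 + 1) : ℝ) : ℂ) * p.2) := by fun_prop
    exact (hexp.aestronglyMeasurable.mul hφ.integrableOn.aestronglyMeasurable.comp_snd).mul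
      hpow.comp_fst
  · rw [Measure.prod_restrict]
    refine (ae_restrict_iff' (measurableSet_Ioi.prod measurableSet_Ioi)).2
      (ae_of_all _ fun p ⟨(hs : 0 < p.1), (hy : 0 < p.2)⟩ => ?_)
    simp only [Function.uncurry]
    rcases eq_or_ne (φ p.2) 0 with hφy | hφy
    · simp [hφy]
    have hay := (hmem _ hy hφy).1
    have hre : (-((t / 2 * (2 * p.1 + 1) : ℝ) : ℂ) * (p.2 : ℂ)).re ≤ -(t * a) * p.1 := by
      rw [← ofReal_neg, ← ofReal_mul, ofReal_re]
      nlinarith [mul_pos ht hy, mul_le_mul_of_nonneg_left hay (mul_pos ht hs).le]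
    rw [norm_mul, norm_mul, norm_exp, norm_real, Real.norm_of_nonneg (by positivity)]
    calc _ ≤ Real.exp (-(t * a) * p.1) * ‖φ p.2‖ * (1 + p.1) ^ (-k) := by gcongr
      _ = _ := by ring

lemma integral_laplace_eq_integral_tricomi (k : ℝ) {t : ℝ} (ht : 0 < t)
    (hφ : IsCompactIntegrable φ) :
    ∫ s in Ioi (0 : ℝ), laplace φ ((t / 2 * (2 * s + 1) : ℝ) : ℂ) / (((1 + s) ^ k : ℝ) : ℂ) =
      ∫ y in Ioi (0 : ℝ), exp (-(t / 2 * y)) * φ y * tricomi k ((t * y : ℝ) : ℂ) := by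
  calc _ = ∫ s in Ioi (0 : ℝ), ∫ y in Ioi (0 : ℝ),
        exp (-((t / 2 * (2 * s + 1) : ℝ) : ℂ) * y) * φ y * (((1 + s) ^ (-k) : ℝ) : ℂ) := by
        refine setIntegral_congr_fun measurableSet_Ioi fun s (hs : 0 < s) => ?_
        rw [integral_mul_const, laplace, Real.rpow_neg (by positivity), ofReal_inv,
          div_eq_mul_inv]
    _ = ∫ y in Ioi (0 : ℝ), ∫ s in Ioi (0 : ℝ),
        exp (-((t / 2 * (2 * s + 1) : ℝ) : ℂ) * y) * φ y * (((1 + s) ^ (-k) : ℝ) : ℂ) :=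
        integral_integral_swap (integrable_uncurry_laplace_integrand k ht hφ)
    _ = _ := by
        refine integral_congr_ae (ae_of_all _ fun y => ?_)
        simp only [tricomi]
        rw [← integral_const_mul]
        refine integral_congr_ae (ae_of_all _ fun s => ?_)
        have hexp : exp (-((t / 2 * (2 * s + 1) : ℝ) : ℂ) * y) =
            exp (-(t / 2 * y)) * exp (-((t * y : ℝ) : ℂ) * s) := by
          rw [← exp_add]
          push_cast
          ring_nf
        simp only [hexp]
        ring

lemma rpow_mul_integral_laplace_twist (k : ℝ) {t : ℝ} (ht : 0 < t) (hφ : IsCompactIntegrable φ) :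
    ((t ^ (1 - k) : ℝ) : ℂ) * ∫ s in Ioi (0 : ℝ),
      laplace (twist φ (2 - k)) ((t / 2 * (2 * s + 1) : ℝ) : ℂ) / (((1 + s) ^ k : ℝ) : ℂ) =
    ∫ y in Ioi (0 : ℝ), (incGamma (1 - k) (t * y) : ℂ) *
      exp (-(I * t / 2) * (y * I)) * φ y := by
  rw [integral_laplace_eq_integral_tricomi k ht (hφ.twist _), ← integral_const_mul]
  refine setIntegral_congr_fun measurableSet_Ioi fun y (hy : 0 < y) => ?_
  have htwist : twist φ (2 - k) y = φ y * ((y ^ (1 - k) : ℝ) : ℂ) := by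
    rw [twist, ofReal_cpow hy.le]
    push_cast
    ring_nf
  have hexp : exp (-(t / 2 * y)) = exp (-(I * t / 2) * (y * I)) * exp (-(t * y)) := by
    rw [← exp_add]
    congr 1
    linear_combination (t * y / 2 : ℂ) * I_sq
  rw [htwist, ← cIncGamma_ofReal k (mul_pos ht hy), cIncGamma, hexp,
    ← ofReal_cpow (mul_pos ht hy).le, Real.mul_rpow ht.le hy.le]
  push_cast
  ring

lemma IsCompactIntegrable.hasSum_mul_integral_laplace_twist (hφ : IsCompactIntegrable φ) (k : ℝ)
    (hx : FreqSummable x) (hpos : ∀ i, 0 < x i) (hc : Subexp x c) :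
    HasSum (fun i => c i * (((x i ^ (1 - k) : ℝ) : ℂ) * ∫ s in Ioi (0 : ℝ),
      laplace (VVMaass.twist φ (2 - k)) ((x i / 2 * (2 * s + 1) : ℝ) : ℂ) /
        (((1 + s) ^ k : ℝ) : ℂ)))
      (∫ y in Ioi (0 : ℝ), nonholSeries k x c (y * I) * φ y) := by
  have him : ∀ y : ℝ, ((y : ℂ) * I).im = y := by simp
  simp_rw [rpow_mul_integral_laplace_twist k (hpos _) hφ, ← integral_const_mul, nonholSeries, him,
    ← mul_assoc]
  refine hφ.hasSum_integral_mul (fun i => ?_) fun a b ha => ?_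
  · have hΓ : ContinuousOn (fun y : ℝ => (incGamma (1 - k) (x i * y) : ℂ)) (Ioi 0) :=
      continuous_ofReal.comp_continuousOn fun y (hy : 0 < y) =>
        (ContinuousAt.comp (f := fun y => x i * y)
          (hasDerivAt_incGamma (1 - k) (mul_pos (hpos i) hy)).continuousAt
          (by fun_prop)).continuousWithinAt
    fun_prop
  · obtain ⟨u, hu, hle⟩ := exists_summable_norm_nonholSeries_le k hx hpos hc ha
    exact ⟨u, hu, fun i y hy => by simpa [mul_assoc] using hle i (y * I) (by simpa using hy.1)⟩

end Laplace

/-! ### Test spaces separate continuous functions -/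

section Separation

variable {ψ : ℝ → ℂ}

lemma IsCompactIntegrable.integral_polynomial_smul_eq_zero (hψ : IsCompactIntegrable ψ)
    (hmoment : ∀ n : ℕ, ∫ y in Ioi (0 : ℝ), (y : ℂ) ^ n * ψ y = 0) (p : Polynomial ℝ) :
    ∫ y in Ioi (0 : ℝ), p.eval y • ψ y = 0 := by
  have hsum : ∀ y : ℝ, p.eval y • ψ y =
      ∑ i ∈ Finset.range (p.natDegree + 1), (p.coeff i : ℂ) * ((y : ℂ) ^ i * ψ y) := fun y => by
    rw [Polynomial.eval_eq_sum_range, real_smul]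
    push_cast
    simp only [Finset.sum_mul, mul_assoc]
  simp_rw [hsum]
  rw [integral_finsetSum _ fun i _ =>
    ((hψ.continuousOn_mul (q := fun y => (y : ℂ) ^ i) (by fun_prop)).integrableOn.const_mul _)]
  simp only [integral_const_mul, hmoment, mul_zero, Finset.sum_const_zero]

lemma IsCompactIntegrable.integrableOn_smul (hψ : IsCompactIntegrable ψ) {g : ℝ → ℝ}
    (hg : Continuous g) : IntegrableOn (fun y => g y • ψ y) (Ioi 0) := by
  simpa only [real_smul] using
    (hψ.continuousOn_mul (q := fun y => (g y : ℂ)) (by fun_prop)).integrableOn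

lemma IsCompactIntegrable.integral_smul_eq_zero (hψ : IsCompactIntegrable ψ)
    (hmoment : ∀ n : ℕ, ∫ y in Ioi (0 : ℝ), (y : ℂ) ^ n * ψ y = 0) {g : ℝ → ℝ}
    (hg : Continuous g) : ∫ y in Ioi (0 : ℝ), g y • ψ y = 0 := by
  obtain ⟨a, b, -, -, hmem⟩ := hψ.exists_mem_Icc
  set N := ∫ y in Ioi (0 : ℝ), ‖ψ y‖
  have hN : 0 ≤ N := integral_nonneg fun y => norm_nonneg _
  rw [← norm_le_zero_iff]
  refine le_of_forall_pos_le_add fun ε hε => ?_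
  obtain ⟨p, hp⟩ := exists_polynomial_near_of_continuousOn a b g hg.continuousOn
    (ε / (N + 1)) (by positivity)
  have hle : ∀ y ∈ Ioi (0 : ℝ), ‖g y • ψ y - p.eval y • ψ y‖ ≤ ε / (N + 1) * ‖ψ y‖ := by
    intro y hy
    rcases eq_or_ne (ψ y) 0 with hψy | hψy
    · simp [hψy]
    · rw [← sub_smul, norm_smul, Real.norm_eq_abs, abs_sub_comm]
      gcongr
      exact (hp y (hmem y hy hψy)).le
  calc ‖∫ y in Ioi (0 : ℝ), g y • ψ y‖
      = ‖∫ y in Ioi (0 : ℝ), (g y • ψ y - p.eval y • ψ y)‖ := by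
        rw [integral_sub (hψ.integrableOn_smul hg) (hψ.integrableOn_smul p.continuous),
          hψ.integral_polynomial_smul_eq_zero hmoment, sub_zero]
    _ ≤ ∫ y in Ioi (0 : ℝ), ε / (N + 1) * ‖ψ y‖ :=
        norm_integral_le_of_norm_le (hψ.integrableOn.norm.const_mul _)
          (ae_restrict_of_forall_mem measurableSet_Ioi hle)
    _ = ε * (N / (N + 1)) := by
        rw [integral_const_mul]
        ring
    _ ≤ 0 + ε := by
        rw [zero_add]
        exact mul_le_of_le_one_right hε.le (div_le_one_of_le₀ (by linarith) (by linarith))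

lemma IsTestSpace.eqOn_zero_of_integral_eq_zero {Sc : Set (ℝ → ℂ)} (hSc : IsTestSpace Sc)
    {G : ℝ → ℂ} (hG : ContinuousOn G (Ioi 0))
    (hint : ∀ φ ∈ Sc, ∫ y in Ioi (0 : ℝ), G y * φ y = 0) : EqOn G 0 (Ioi 0) := by
  intro x hx
  obtain ⟨φ, hφ, hφx⟩ := hSc.exists_ne_zero x hx
  have hφtest := hSc.isTestFunction φ hφ
  have hGφ := hφtest.isCompactIntegrable.continuousOn_mul hG
  have hae : ∀ᵐ y ∂volume.restrict (Ioi (0 : ℝ)), G y * φ y = 0 := by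
    refine ae_eq_zero_of_integral_contDiff_smul_eq_zero hGφ.integrableOn.locallyIntegrable
      fun g hg _ => hGφ.integral_smul_eq_zero (fun n => ?_) hg.continuous
    rw [← hint _ (hSc.twist_mem φ hφ (n + 1))]
    refine integral_congr_ae (ae_of_all _ fun y => ?_)
    simp only [twist, add_sub_cancel_right, cpow_natCast]
    ring
  set U := interior (Function.support φ)
  have hsupp : Function.support φ ⊆ Ioi 0 := (subset_tsupport φ).trans hφtest.support_pos
  have hUsub : U ⊆ Ioi 0 := interior_subset.trans hsupp
  have hGU : G =ᵐ[volume.restrict U] 0 := by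
    filter_upwards [ae_restrict_of_ae_restrict_of_subset hUsub hae,
      ae_restrict_mem isOpen_interior.measurableSet] with y hy hyU
    exact (mul_eq_zero.1 hy).resolve_right (interior_subset hyU)
  have hEqU : EqOn G 0 U :=
    Measure.eqOn_open_of_ae_eq hGU isOpen_interior (hG.mono hUsub) continuousOn_const
  exact hEqU.of_subset_closure (hG.mono hsupp) continuousOn_const interior_subset
    hφtest.support_subset_closure_interior hφx

end Separation

/-! ### The Fourier series and its frequencies -/

/-- The frequencies `2π(n + κ)`, `n ≥ -n₀`, of the holomorphic part. -/
def holFreq (n₀ : ℕ) (κ : ℝ) (n : {n : ℤ // -(n₀ : ℤ) ≤ n}) : ℝ := 2 * Real.pi * ((n : ℤ) + κ)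

/-- The parameters `-4π(n + κ)`, `n + κ < 0`, of the nonholomorphic part. They are twice the
absolute frequencies, as these are what multiplies `v` in the incomplete gamma function. -/
def nonholFreq (κ : ℝ) (n : {n : ℤ // (n : ℝ) + κ < 0}) : ℝ := -4 * Real.pi * ((n : ℤ) + κ)

lemma nonholFreq_pos (κ : ℝ) (n : {n : ℤ // (n : ℝ) + κ < 0}) : 0 < nonholFreq κ n :=
  mul_pos_of_neg_of_neg (by linarith [Real.pi_pos]) n.2

lemma two_pi_mul_abs_le_holFreq_add (n₀ : ℕ) (κ : ℝ) (n : {n : ℤ // -(n₀ : ℤ) ≤ n}) :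
    2 * Real.pi * |((n : ℤ) : ℝ)| ≤ holFreq n₀ κ n + 2 * Real.pi * (2 * n₀ - κ) := by
  have hn : -(n₀ : ℝ) ≤ (n : ℤ) := by exact_mod_cast n.2
  have habs : |((n : ℤ) : ℝ)| ≤ (n : ℤ) + 2 * n₀ := abs_le'.2
    ⟨by linarith [n₀.cast_nonneg (α := ℝ)], by linarith⟩
  rw [holFreq]
  nlinarith [Real.pi_pos]

lemma four_pi_mul_abs_le_nonholFreq_add (κ : ℝ) (n : {n : ℤ // (n : ℝ) + κ < 0}) :
    4 * Real.pi * |((n : ℤ) : ℝ)| ≤ nonholFreq κ n + 4 * Real.pi * (2 * |κ| + κ) := by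
  have habs : |((n : ℤ) : ℝ)| ≤ -(n : ℤ) + 2 * |κ| := abs_le'.2
    ⟨by linarith [n.2, neg_abs_le κ], by linarith [abs_nonneg κ]⟩
  rw [nonholFreq]
  nlinarith [Real.pi_pos]

lemma tendsto_cofinite_atTop_coe (n₀ : ℕ) :
    Tendsto (fun n : {n : ℤ // -(n₀ : ℤ) ≤ n} => (n : ℤ)) cofinite atTop :=
  tendsto_atTop.2 fun b => ((finite_Icc (-(n₀ : ℤ)) b).preimage
    Subtype.val_injective.injOn).subset fun n hn => ⟨n.2, (not_le.1 (notMem_of_mem_compl hn)).le⟩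

lemma tendsto_cofinite_atBot_coe (κ : ℝ) :
    Tendsto (fun n : {n : ℤ // (n : ℝ) + κ < 0} => (n : ℤ)) cofinite atBot :=
  tendsto_atBot.2 fun b => ((finite_Icc b ⌊-κ⌋).preimage
    Subtype.val_injective.injOn).subset fun n hn =>
      ⟨(not_le.1 (notMem_of_mem_compl hn)).le, Int.le_floor.2 (by linarith [n.2])⟩

section FreqOfInt

variable {ι : Type*} {x : ι → ℝ} {e : ι → ℤ} {s B : ℝ}

lemma freqSummable_of_injective (he : Function.Injective e) (hs : 0 < s)
    (hx : ∀ i, s * |(e i : ℝ)| ≤ x i + B) : FreqSummable x := fun ε hε => by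
  have hnat : Summable fun n : ℕ => Real.exp (-(ε * s)) ^ n :=
    summable_geometric_of_lt_one (Real.exp_nonneg _) (by simpa using mul_pos hε hs)
  have hint : Summable fun n : ℤ => Real.exp (-(ε * s)) ^ n.natAbs :=
    .of_nat_of_neg (by simpa using hnat) (by simpa using hnat)
  refine .of_nonneg_of_le (fun i => Real.exp_nonneg _) (fun i => ?_)
    ((hint.mul_left (Real.exp (ε * B))).comp_injective he)
  rw [Function.comp_apply, ← Real.exp_nat_mul, ← Real.exp_add, Real.exp_le_exp, Nat.cast_natAbs,
    Int.cast_abs]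
  nlinarith [hx i]

lemma subexp_comp_of_isBigO {l : Filter ℤ} (he : Tendsto e cofinite l) (hs : 0 < s)
    (hx : ∀ i, s * |(e i : ℝ)| ≤ x i + B) {c : ℤ → ℂ}
    (hc : ∀ ε > 0, c =O[l] fun n : ℤ => Real.exp (ε * |(n : ℝ)|)) :
    Subexp x fun i => c (e i) := fun ε hε => by
  have hexp : (fun i => Real.exp (ε * s * |(e i : ℝ)|)) =O[cofinite]
      fun i => Real.exp (ε * x i) := by
    refine .of_bound (Real.exp (ε * B)) (.of_forall fun i => ?_)
    rw [Real.norm_of_nonneg (Real.exp_nonneg _), Real.norm_of_nonneg (Real.exp_nonneg _),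
      ← Real.exp_add, Real.exp_le_exp]
    nlinarith [hx i]
  have hbound := ((hc _ (mul_pos hε hs)).comp_tendsto he).trans hexp
  rw [Asymptotics.isBigO_cofinite_iff fun i hi => (Real.exp_ne_zero _ hi).elim] at hbound
  obtain ⟨K, hK⟩ := hbound
  refine ⟨max K 0, le_max_right _ _, fun i => (hK i).trans ?_⟩
  rw [Real.norm_of_nonneg (Real.exp_nonneg _)]
  gcongr
  exact le_max_left _ _

end FreqOfInt

lemma freqSummable_holFreq (n₀ : ℕ) (κ : ℝ) : FreqSummable (holFreq n₀ κ) :=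
  freqSummable_of_injective Subtype.val_injective Real.two_pi_pos
    (two_pi_mul_abs_le_holFreq_add n₀ κ)

lemma freqSummable_nonholFreq (κ : ℝ) : FreqSummable (nonholFreq κ) :=
  freqSummable_of_injective Subtype.val_injective (by positivity)
    (four_pi_mul_abs_le_nonholFreq_add κ)

lemma isBigO_exp_mul_sqrt_exp_mul (C : ℝ) {ε : ℝ} (hε : 0 < ε) (l : Filter ℤ) :
    (fun n : ℤ => Real.exp (C * Real.sqrt |(n : ℝ)|)) =O[l] fun n => Real.exp (ε * |(n : ℝ)|) := by
  refine .of_bound (Real.exp (C ^ 2 / (4 * ε))) (.of_forall fun n => ?_)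
  rw [Real.norm_of_nonneg (Real.exp_nonneg _), Real.norm_of_nonneg (Real.exp_nonneg _),
    ← Real.exp_add, Real.exp_le_exp, div_add' _ _ _ (by positivity), le_div_iff₀ (by positivity)]
  linear_combination sq_nonneg (C - 2 * ε * Real.sqrt |(n : ℝ)|) +
    4 * ε ^ 2 * Real.sq_sqrt (abs_nonneg (n : ℝ))

lemma holTerm_eq (n₀ : ℕ) (κ : ℝ) (c : ℤ → ℂ) (τ : ℍ) (n : {n : ℤ // -(n₀ : ℤ) ≤ n}) :
    holTerm κ c τ n = c n * exp (I * holFreq n₀ κ n * τ) := by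
  rw [holTerm, holFreq]
  push_cast
  ring_nf

lemma nonholTerm_eq (k κ : ℝ) (c : ℤ → ℂ) (τ : ℍ) (n : {n : ℤ // (n : ℝ) + κ < 0}) :
    nonholTerm k κ c τ n = c n * (incGamma (1 - k) (nonholFreq κ n * (τ : ℂ).im) : ℂ) *
      exp (-(I * nonholFreq κ n / 2) * τ) := by
  rw [nonholTerm, nonholFreq]
  congr 2
  push_cast
  ring

section MaassFun

variable {m : ℕ} {k : ℝ} {κ : Fin m → ℝ} {n₀ : ℕ} {cp cm : Fin m → ℤ → ℂ} {z : ℂ}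

/-- The function of a complex variable which agrees with `maassSeries` on the upper half plane. -/
def maassFun (k : ℝ) (κ : Fin m → ℝ) (n₀ : ℕ) (cp cm : Fin m → ℤ → ℂ) (z : ℂ) (j : Fin m) : ℂ :=
  holSeries (holFreq n₀ (κ j)) (fun n => cp j n) z +
    nonholSeries k (nonholFreq (κ j)) (fun n => cm j n) z

lemma maassSeries_eq (k : ℝ) (κ : Fin m → ℝ) (n₀ : ℕ) (cp cm : Fin m → ℤ → ℂ) (τ : ℍ) :
    maassSeries k κ n₀ cp cm τ = maassFun k κ n₀ cp cm τ := by
  funext j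
  simp only [maassSeries, maassFun, holSeries, nonholSeries, holTerm_eq, nonholTerm_eq]

lemma maassSeries_ofComplex_eventuallyEq (k : ℝ) (κ : Fin m → ℝ) (n₀ : ℕ)
    (cp cm : Fin m → ℤ → ℂ) (hz : 0 < z.im) :
    (fun z : ℂ => maassSeries k κ n₀ cp cm (UpperHalfPlane.ofComplex z)) =ᶠ[𝓝 z]
      maassFun k κ n₀ cp cm := by
  filter_upwards [(isOpen_lt continuous_const continuous_im).mem_nhds hz] with w hw
  rw [maassSeries_eq, UpperHalfPlane.ofComplex_apply_of_im_pos hw]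

/-- Subexponential growth of all coefficients of `maassFun`, relative to its frequencies. -/
structure SubexpCoeffs (κ : Fin m → ℝ) (n₀ : ℕ) (cp cm : Fin m → ℤ → ℂ) : Prop where
  hol : ∀ j, Subexp (holFreq n₀ (κ j)) fun n => cp j n
  nonhol : ∀ j, Subexp (nonholFreq (κ j)) fun n => cm j n

lemma subexpCoeffs_of_isBigO (κ : Fin m → ℝ) (n₀ : ℕ)
    (h : ∀ ε > 0, ∀ j, cp j =O[atTop] (fun n : ℤ => Real.exp (ε * |(n : ℝ)|)) ∧
      cm j =O[atBot] fun n : ℤ => Real.exp (ε * |(n : ℝ)|)) :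
    SubexpCoeffs κ n₀ cp cm where
  hol j := subexp_comp_of_isBigO (tendsto_cofinite_atTop_coe n₀) Real.two_pi_pos
    (two_pi_mul_abs_le_holFreq_add n₀ (κ j)) fun ε hε => (h ε hε j).1
  nonhol j := subexp_comp_of_isBigO (tendsto_cofinite_atBot_coe (κ j)) (by positivity)
    (four_pi_mul_abs_le_nonholFreq_add (κ j)) fun ε hε => (h ε hε j).2

/-- The coefficients of `(2πi)⁻¹ ∂f/∂u`, where `f` has the coefficients `c`. -/
def derivCoeff (κ : Fin m → ℝ) (c : Fin m → ℤ → ℂ) (j : Fin m) (n : ℤ) : ℂ :=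
  c j n * ((n + κ j : ℝ) : ℂ)

lemma SubexpCoeffs.deriv (h : SubexpCoeffs κ n₀ cp cm) :
    SubexpCoeffs κ n₀ (derivCoeff κ cp) (derivCoeff κ cm) where
  hol j := by
    convert! ((h.hol j).mul (subexp_ofReal (freqSummable_holFreq n₀ (κ j)))).const_mul
      (2 * Real.pi : ℂ)⁻¹ using 2 with n
    rw [derivCoeff, holFreq]
    push_cast
    field_simp [ofReal_ne_zero.2 Real.pi_ne_zero]
  nonhol j := by
    convert! ((h.nonhol j).mul (subexp_ofReal (freqSummable_nonholFreq (κ j)))).const_mul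
      (-4 * Real.pi : ℂ)⁻¹ using 2 with n
    rw [derivCoeff, nonholFreq]
    push_cast
    field_simp [ofReal_ne_zero.2 Real.pi_ne_zero]

lemma SubexpCoeffs.hasShadow (k : ℝ) (h : SubexpCoeffs κ n₀ cp cm) :
    HasShadow k (maassFun k κ n₀ cp cm)
      fun z j => shadowSeries k (nonholFreq (κ j)) (fun n => cm j n) z := by
  refine HasShadow.pi fun j => ?_
  have hsum := (hasShadow_holSeries k (freqSummable_holFreq n₀ (κ j)) (h.hol j)).add
    (hasShadow_nonholSeries k (freqSummable_nonholFreq (κ j)) (nonholFreq_pos (κ j)) (h.nonhol j))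
  rwa [zero_add] at hsum

lemma SubexpCoeffs.analyticAt (k : ℝ) (h : SubexpCoeffs κ n₀ cp cm) (hz : 0 < z.im) :
    AnalyticAt ℝ (maassFun k κ n₀ cp cm) z :=
  .pi fun j =>
    (analyticAt_holSeries (freqSummable_holFreq n₀ (κ j)) (h.hol j) hz).restrictScalars.add
      (analyticAt_nonholSeries k (freqSummable_nonholFreq (κ j)) (nonholFreq_pos (κ j))
        (h.nonhol j) hz)

lemma SubexpCoeffs.fderiv_one (k : ℝ) (h : SubexpCoeffs κ n₀ cp cm) (hz : 0 < z.im) :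
    fderiv ℝ (maassFun k κ n₀ cp cm) z 1 = (2 * Real.pi * I : ℂ) •
      maassFun k κ n₀ (derivCoeff κ cp) (derivCoeff κ cm) z := by
  funext j
  have hx := freqSummable_holFreq n₀ (κ j)
  have hy := freqSummable_nonholFreq (κ j)
  have hpos := nonholFreq_pos (κ j)
  have hF := hasFDerivAt_pi'.1 (h.analyticAt k hz).differentiableAt.hasFDerivAt j
  have hsum := ((hasShadow_holSeries k hx (h.hol j)).differentiableAt z hz).hasFDerivAt.add
    ((hasShadow_nonholSeries k hy hpos (h.nonhol j)).differentiableAt z hz).hasFDerivAt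
  refine (DFunLike.congr_fun (hF.unique hsum) 1).trans ?_
  rw [add_apply, fderiv_holSeries_one hx (h.hol j) hz,
    fderiv_nonholSeries_one k hy hpos (h.nonhol j) hz]
  simp only [Pi.smul_apply, smul_eq_mul, maassFun, holSeries, nonholSeries, mul_add,
    ← tsum_mul_left]
  congr 1
  · refine tsum_congr fun n => ?_
    rw [derivCoeff, holFreq]
    push_cast
    ring
  · refine tsum_congr fun n => ?_
    rw [derivCoeff, nonholFreq]
    push_cast
    ring

lemma SubexpCoeffs.continuousOn_mul_I (k : ℝ) (h : SubexpCoeffs κ n₀ cp cm) (j : Fin m) :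
    ContinuousOn (fun y : ℝ => maassFun k κ n₀ cp cm (y * I) j) (Ioi 0) := fun y hy =>
  (ContinuousAt.comp (f := fun y : ℝ => (y : ℂ) * I) (continuousAt_pi.1
    (h.analyticAt k (by simpa using hy)).continuousAt j) (by fun_prop)).continuousWithinAt

lemma maassFun_add_one (k : ℝ) (κ : Fin m → ℝ) (n₀ : ℕ) (cp cm : Fin m → ℤ → ℂ) (z : ℂ)
    (j : Fin m) : maassFun k κ n₀ cp cm (z + 1) j =
      exp (2 * Real.pi * I * κ j) * maassFun k κ n₀ cp cm z j := by
  have hexp (n : ℤ) (a : ℂ) (ha : a = 2 * Real.pi * I * (n + κ j)) :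
      exp (a * (z + 1)) = exp (2 * Real.pi * I * κ j) * exp (a * z) := by
    rw [← exp_add, exp_eq_exp_iff_exists_int]
    exact ⟨n, by rw [ha]; ring⟩
  simp only [maassFun, holSeries, nonholSeries, mul_add (exp _), ← tsum_mul_left]
  congr 1
  · refine tsum_congr fun n => ?_
    rw [hexp n _ (by rw [holFreq]; push_cast; ring)]
    ring
  · refine tsum_congr fun n => ?_
    rw [hexp n _ (by rw [nonholFreq]; push_cast; ring), add_im, one_im, add_zero]
    ring

end MaassFun

/-! ### `L`-series as integrals along the imaginary axis -/

section LSeries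

variable {m : ℕ} {κ : Fin m → ℝ} {n₀ : ℕ} {cp cm : Fin m → ℤ → ℂ} {φ ψ : ℝ → ℂ}

lemma laplace_congr (h : EqOn φ ψ (Ioi 0)) (s : ℂ) : laplace φ s = laplace ψ s :=
  setIntegral_congr_fun measurableSet_Ioi fun t ht => by simp only [h ht]

lemma twist_twist_eqOn (φ : ℝ → ℂ) (s t : ℂ) :
    EqOn (twist (twist φ s) t) (twist φ (s + t - 1)) (Ioi 0) := fun y (hy : 0 < y) => by
  rw [twist, twist, twist, mul_assoc, ← cpow_add _ _ (ofReal_ne_zero.2 hy.ne')]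
  ring_nf

lemma nonholKernel_eq (k κ : ℝ) (h : EqOn φ ψ (Ioi 0)) (n : {n : ℤ // (n : ℝ) + κ < 0}) :
    nonholKernel k κ φ n = ((nonholFreq κ n ^ (1 - k) : ℝ) : ℂ) * ∫ t in Ioi (0 : ℝ),
      laplace ψ ((nonholFreq κ n / 2 * (2 * t + 1) : ℝ) : ℂ) / (((1 + t) ^ k : ℝ) : ℂ) := by
  rw [nonholKernel, nonholFreq]
  simp_rw [laplace_congr h]
  ring_nf

lemma SubexpCoeffs.tsum_laplace_eq_integral (h : SubexpCoeffs κ n₀ cp cm) (k : ℝ)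
    (hφ : IsCompactIntegrable φ) (hψ : EqOn ψ (twist φ (2 - k)) (Ioi 0)) (j : Fin m) :
    (∑' n : {n : ℤ // -(n₀ : ℤ) ≤ n},
        cp j n * laplace φ ((2 * Real.pi * (((n : ℤ) : ℝ) + κ j) : ℝ) : ℂ)) +
      ∑' n : {n : ℤ // (n : ℝ) + κ j < 0}, cm j n * nonholKernel k (κ j) ψ n =
    ∫ y in Ioi (0 : ℝ), maassFun k κ n₀ cp cm (y * I) j * φ y := by
  have hx := freqSummable_holFreq n₀ (κ j)
  have hhol := hφ.hasSum_mul_laplace hx (h.hol j)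
  have hnonhol := hφ.hasSum_mul_integral_laplace_twist k (freqSummable_nonholFreq (κ j))
    (nonholFreq_pos (κ j)) (h.nonhol j)
  have hcont : ContinuousOn (fun y : ℝ => holSeries (holFreq n₀ (κ j)) (fun n => cp j n) (y * I))
      (Ioi 0) := fun y hy => (ContinuousAt.comp (f := fun y : ℝ => (y : ℂ) * I)
    (analyticAt_holSeries hx (h.hol j) (by simpa using hy)).continuousAt
      (by fun_prop)).continuousWithinAt
  have hcont' : ContinuousOn (fun y : ℝ => nonholSeries k (nonholFreq (κ j)) (fun n => cm j n)
      (y * I)) (Ioi 0) :=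
    ((h.continuousOn_mul_I k j).sub hcont).congr fun y _ => by simp [maassFun]
  simp_rw [nonholKernel_eq k (κ j) hψ, maassFun, add_mul]
  rw [integral_add (hφ.continuousOn_mul hcont).1 (hφ.continuousOn_mul hcont').1, ← hnonhol.tsum_eq,
    ← hhol.tsum_eq]
  rfl

lemma SubexpCoeffs.Lf_eq_integral (h : SubexpCoeffs κ n₀ cp cm) (k : ℝ)
    (hφ : IsCompactIntegrable φ) :
    Lf k κ n₀ cp cm φ = fun j => ∫ y in Ioi (0 : ℝ), maassFun k κ n₀ cp cm (y * I) j * φ y :=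
  funext (h.tsum_laplace_eq_integral k hφ (eqOn_refl _ _))

lemma SubexpCoeffs.delta_mul_I (h : SubexpCoeffs κ n₀ cp cm) (k : ℝ) {y : ℝ} (hy : 0 < y)
    (j : Fin m) : delta k (maassFun k κ n₀ cp cm) (y * I) j =
      k / 2 * maassFun k κ n₀ cp cm (y * I) j -
        2 * Real.pi * y * maassFun k κ n₀ (derivCoeff κ cp) (derivCoeff κ cm) (y * I) j := by
  rw [delta, h.fderiv_one k (by simpa using hy)]
  simp only [Pi.add_apply, Pi.smul_apply, smul_eq_mul]
  linear_combination (2 * Real.pi * y *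
    maassFun k κ n₀ (derivCoeff κ cp) (derivCoeff κ cm) (y * I) j) * I_sq

lemma SubexpCoeffs.continuousOn_delta_mul_I (h : SubexpCoeffs κ n₀ cp cm) (k : ℝ) (j : Fin m) :
    ContinuousOn (fun y : ℝ => delta k (maassFun k κ n₀ cp cm) (y * I) j) (Ioi 0) :=
  ((continuousOn_const.mul (h.continuousOn_mul_I k j)).sub ((continuousOn_const.mul
    continuous_ofReal.continuousOn).mul (h.deriv.continuousOn_mul_I k j))).congr
    fun _ hy => h.delta_mul_I k hy j

lemma SubexpCoeffs.Ldeltaf_eq_integral (h : SubexpCoeffs κ n₀ cp cm) (k : ℝ)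
    (hφ : IsCompactIntegrable φ) :
    Ldeltaf k κ n₀ cp cm φ =
      fun j => ∫ y in Ioi (0 : ℝ), delta k (maassFun k κ n₀ cp cm) (y * I) j * φ y := by
  funext j
  have htwist : EqOn (twist φ (3 - k)) (twist (twist φ 2) (2 - k)) (Ioi 0) := fun y hy => by
    rw [twist_twist_eqOn φ 2 (2 - k) hy]
    ring_nf
  have hderiv := h.deriv.tsum_laplace_eq_integral k (hφ.twist 2) htwist j
  simp only [derivCoeff] at hderiv
  have hint := (hφ.continuousOn_mul (h.continuousOn_mul_I k j)).integrableOn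
  have hint' := ((hφ.twist 2).continuousOn_mul (h.deriv.continuousOn_mul_I k j)).integrableOn
  rw [Ldeltaf, h.Lf_eq_integral k hφ, sub_sub, ← mul_add, hderiv, ← integral_const_mul,
    ← integral_const_mul, ← integral_sub (hint.const_mul _) (hint'.const_mul _)]
  refine setIntegral_congr_fun measurableSet_Ioi fun y hy => ?_
  have hcpow : (y : ℂ) ^ ((2 : ℂ) - 1) = y := by norm_num
  simp only [h.delta_mul_I k hy, twist, hcpow]
  ring

end LSeries

/-! ### Functional equations on the imaginary axis -/

lemma IsTestSpace.eq_smul_mulVec_inv {n : Type*} [Fintype n] {Sc : Set (ℝ → ℂ)}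
    (hSc : IsTestSpace Sc) (k : ℝ) (χ : SL(2, ℤ) → ℂ) (A : Matrix n n ℂ) {P : ℝ → n → ℂ}
    (hP : ∀ j, ContinuousOn (fun y => P y j) (Ioi 0))
    (h : ∀ φ ∈ Sc, (fun j => ∫ y in Ioi (0 : ℝ), P y j * φ y) =
      A.mulVec fun j => ∫ y in Ioi (0 : ℝ), P y j * testSlash k χ φ y) {y : ℝ} (hy : 0 < y) :
    P y = (χ ModularGroup.S * ((y ^ (-k) : ℝ) : ℂ)) • A.mulVec (P y⁻¹) := by
  set Q : n → ℝ → ℂ := fun j y => χ ModularGroup.S * ((y ^ (-k) : ℝ) : ℂ) * P y⁻¹ j with hQdef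
  have hQ : ∀ j, ContinuousOn (Q j) (Ioi 0) := fun j =>
    (continuousOn_const.mul (continuousOn_ofReal_rpow (-k))).mul <| (hP j).comp
      (continuousOn_inv₀.mono fun y (hy : 0 < y) => hy.ne') fun y (hy : 0 < y) => inv_pos.2 hy
  funext j
  have hzero : EqOn (fun y => P y j - ∑ l, A j l * Q l y) 0 (Ioi 0) := by
    refine hSc.eqOn_zero_of_integral_eq_zero ((hP j).sub
      (continuousOn_finsetSum _ fun l _ => continuousOn_const.mul (hQ l))) fun φ hφ => ?_
    have hφi := (hSc.isTestFunction φ hφ).isCompactIntegrable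
    have hQint : ∀ l, IntegrableOn (fun y => A j l * (Q l y * φ y)) (Ioi 0) := fun l =>
      (hφi.continuousOn_mul (hQ l)).integrableOn.const_mul _
    have hj := congrFun (h φ hφ) j
    simp only [integral_mul_testSlash, Matrix.mulVec, dotProduct] at hj
    simp_rw [sub_mul, Finset.sum_mul, mul_assoc (A j _)]
    rw [integral_sub (hφi.continuousOn_mul (hP j)).integrableOn
      (integrable_finsetSum _ fun l _ => hQint l), integral_finsetSum _ fun l _ => hQint l, hj,
      sub_eq_zero]
    simp only [integral_const_mul, hQdef]
  rw [sub_eq_zero.1 (hzero hy), Pi.smul_apply, Matrix.mulVec, dotProduct, smul_eq_mul,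
    Finset.mul_sum]
  exact Finset.sum_congr rfl fun l _ => by ring

lemma ofReal_mul_I_cpow {y : ℝ} (hy : 0 < y) (s : ℂ) :
    ((y : ℂ) * I) ^ s = (y : ℂ) ^ s * I ^ s := by
  have hy0 : (y : ℂ) ≠ 0 := ofReal_ne_zero.2 hy.ne'
  rw [cpow_def_of_ne_zero (mul_ne_zero hy0 I_ne_zero), cpow_def_of_ne_zero hy0,
    cpow_def_of_ne_zero I_ne_zero, log_ofReal_mul hy I_ne_zero, ← exp_add, ofReal_log hy.le,
    add_mul]

lemma IsTestSpace.inversion_on_imaginary_axis {n : Type*} [Fintype n] {Sc : Set (ℝ → ℂ)}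
    (hSc : IsTestSpace Sc) (k : ℝ) (χ : SL(2, ℤ) → ℂ) (R : Matrix n n ℂ) (ε : ℂ) {G : ℂ → n → ℂ}
    (hG : ∀ j, ContinuousOn (fun y : ℝ => G (y * I) j) (Ioi 0))
    (h : ∀ φ ∈ Sc, (fun j => ∫ y in Ioi (0 : ℝ), G (y * I) j * φ y) =
      (ε * I ^ (k : ℂ)) • R.mulVec fun j => ∫ y in Ioi (0 : ℝ), G (y * I) j * testSlash k χ φ y)
    {y : ℝ} (hy : 0 < y) :
    G (-(y * I)⁻¹) = (ε * (y * I) ^ (k : ℂ)) • χ ModularGroup.S • R.mulVec (G (y * I)) := by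
  have haxis := hSc.eq_smul_mulVec_inv k χ ((ε * I ^ (k : ℂ)) • R) (P := fun y => G (y * I)) hG
    (fun φ hφ => by rw [h φ hφ, Matrix.smul_mulVec]) (inv_pos.2 hy)
  have hinv : -((y : ℂ) * I)⁻¹ = ((y⁻¹ : ℝ) : ℂ) * I := by
    rw [mul_inv, inv_I]
    push_cast
    ring
  rw [hinv, haxis, inv_inv, Real.inv_rpow hy.le, Real.rpow_neg hy.le, inv_inv, ofReal_cpow hy.le,
    ofReal_mul_I_cpow hy, Matrix.smul_mulVec, smul_smul, smul_smul]
  ring_nf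

/-! ### Modularity -/

section Modularity

variable {m : ℕ} {k : ℝ} {χ : SL(2, ℤ) → ℂ} {ρ : SL(2, ℤ) →* Matrix.unitaryGroup (Fin m) ℂ}
  {f : ℍ → Fin m → ℂ} {γ γ₁ γ₂ : SL(2, ℤ)}

/-- The transformation law `f(γτ) = χ(γ) (cτ + d)^k ρ(γ) f(τ)` under a single `γ`. For a multiplier
system `χ` it is equivalent to invariance of `f` under the slash operator, but unlike the latter it
involves no inverses. -/
def Transforms (k : ℝ) (χ : SL(2, ℤ) → ℂ) (ρ : SL(2, ℤ) →* Matrix.unitaryGroup (Fin m) ℂ)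
    (f : ℍ → Fin m → ℂ) (γ : SL(2, ℤ)) : Prop :=
  ∀ τ, f (γ • τ) = (χ γ * autFactor k γ τ) • (ρ γ).1.mulVec (f τ)

lemma autFactor_one (k : ℝ) (τ : ℍ) : autFactor k 1 τ = 1 := by
  simp [autFactor]

lemma IsMultiplierSystem.map_one (hχ : IsMultiplierSystem k χ) : χ 1 = 1 := by
  have hne : χ 1 ≠ 0 := norm_ne_zero_iff.1 (by simp [hχ.norm_eq_one])
  have hcons := hχ.consistency 1 1 UpperHalfPlane.I
  rw [mul_one, one_smul, autFactor_one, mul_one, mul_one, mul_one] at hcons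
  exact (mul_eq_left₀ hne).1 hcons.symm

lemma IsMultiplierSystem.factor_inv_mul_factor (hχ : IsMultiplierSystem k χ) (γ : SL(2, ℤ))
    (τ : ℍ) : χ γ⁻¹ * autFactor k γ⁻¹ (γ • τ) * (χ γ * autFactor k γ τ) = 1 := by
  have hcons := hχ.consistency γ⁻¹ γ τ
  rw [inv_mul_cancel, hχ.map_one, autFactor_one] at hcons
  linear_combination -hcons

lemma unitaryGroup_inv_mulVec_mulVec (U : Matrix.unitaryGroup (Fin m) ℂ) (v : Fin m → ℂ) :
    (U⁻¹).1.mulVec (U.1.mulVec v) = v := by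
  rw [Matrix.mulVec_mulVec, ← Submonoid.coe_mul, inv_mul_cancel, Submonoid.coe_one,
    Matrix.one_mulVec]

lemma transforms_one (hχ : IsMultiplierSystem k χ) (f : ℍ → Fin m → ℂ) :
    Transforms k χ ρ f 1 := fun τ => by
  simp [autFactor_one, hχ.map_one]

lemma Transforms.mul (hχ : IsMultiplierSystem k χ) (h₁ : Transforms k χ ρ f γ₁)
    (h₂ : Transforms k χ ρ f γ₂) : Transforms k χ ρ f (γ₁ * γ₂) := fun τ => by
  rw [mul_smul, h₁, h₂, map_mul, Submonoid.coe_mul, ← Matrix.mulVec_mulVec, Matrix.mulVec_smul,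
    smul_smul, hχ.consistency γ₁ γ₂ τ]
  ring_nf

lemma Transforms.inv (hχ : IsMultiplierSystem k χ) (h : Transforms k χ ρ f γ) :
    Transforms k χ ρ f γ⁻¹ := fun τ => by
  have hτ := h (γ⁻¹ • τ)
  have hfactor := hχ.factor_inv_mul_factor γ (γ⁻¹ • τ)
  rw [smul_inv_smul] at hτ hfactor
  rw [hτ, Matrix.mulVec_smul, map_inv, unitaryGroup_inv_mulVec_mulVec, smul_smul, hfactor,
    one_smul]

lemma transforms_of_generators (hχ : IsMultiplierSystem k χ)
    (hS : Transforms k χ ρ f ModularGroup.S) (hT : Transforms k χ ρ f ModularGroup.T)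
    (γ : SL(2, ℤ)) : Transforms k χ ρ f γ := by
  have hγ : γ ∈ Subgroup.closure {ModularGroup.S, ModularGroup.T} := by
    rw [SpecialLinearGroup.SL2Z_generators]
    exact Subgroup.mem_top γ
  induction hγ using Subgroup.closure_induction with
  | mem γ hγ =>
    obtain rfl | rfl := hγ
    · exact hS
    · exact hT
  | one => exact transforms_one hχ f
  | mul _ _ _ _ h₁ h₂ => exact h₁.mul hχ h₂
  | inv _ _ h => exact h.inv hχ

lemma Transforms.slash_eq (hχ : IsMultiplierSystem k χ) (h : Transforms k χ ρ f γ) :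
    slash k χ ρ f γ = f := by
  funext τ
  have hne : χ γ * autFactor k γ τ ≠ 0 :=
    right_ne_zero_of_mul_eq_one (hχ.factor_inv_mul_factor γ τ)
  have hneg : autFactor (-k) γ τ = (autFactor k γ τ)⁻¹ := by
    rw [autFactor, autFactor, ofReal_neg, cpow_neg]
  rw [slash, h τ, Matrix.mulVec_smul, unitaryGroup_inv_mulVec_mulVec, smul_smul, hneg,
    ← mul_inv_rev, inv_mul_cancel₀ hne, one_smul]

variable {κ : Fin m → ℝ} {n₀ : ℕ} {cp cm : Fin m → ℤ → ℂ} {Sc : Set (ℝ → ℂ)}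

lemma transforms_T (k : ℝ) (n₀ : ℕ) (cp cm : Fin m → ℤ → ℂ)
    (hT : ∀ j, χ ModularGroup.T • (ρ ModularGroup.T).1.mulVec (Pi.single j 1) =
      exp (2 * Real.pi * I * (κ j : ℂ)) • (Pi.single j 1 : Fin m → ℂ)) :
    Transforms k χ ρ (maassSeries k κ n₀ cp cm) ModularGroup.T := fun τ => by
  have hτ : ((ModularGroup.T • τ : ℍ) : ℂ) = τ + 1 := by
    rw [UpperHalfPlane.modular_T_smul, UpperHalfPlane.coe_vadd, ofReal_one, add_comm]
  have hfactor : autFactor k ModularGroup.T τ = 1 := by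
    simp [autFactor, ModularGroup.T]
  have hdiag (j l : Fin m) : χ ModularGroup.T * (ρ ModularGroup.T).1 j l =
      if j = l then exp (2 * Real.pi * I * (κ l : ℂ)) else 0 := by
    simpa [Matrix.mulVec_single, Pi.single_apply] using congrFun (hT l) j
  funext j
  rw [maassSeries_eq, maassSeries_eq, hτ, maassFun_add_one, hfactor, mul_one, Pi.smul_apply,
    Matrix.mulVec, dotProduct, smul_eq_mul, Finset.mul_sum]
  simp_rw [← mul_assoc, hdiag]
  simp

lemma SubexpCoeffs.transforms_S (h : SubexpCoeffs κ n₀ cp cm) (hSc : IsTestSpace Sc)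
    (hL : ∀ φ ∈ Sc, Lf k κ n₀ cp cm φ = I ^ (k : ℂ) •
      (ρ ModularGroup.S).1.mulVec (Lf k κ n₀ cp cm (testSlash k χ φ)))
    (hLdelta : ∀ φ ∈ Sc, Ldeltaf k κ n₀ cp cm φ = (-I ^ (k : ℂ)) •
      (ρ ModularGroup.S).1.mulVec (Ldeltaf k κ n₀ cp cm (testSlash k χ φ))) :
    Transforms k χ ρ (maassSeries k κ n₀ cp cm) ModularGroup.S := fun τ => by
  let M : (Fin m → ℂ) →L[ℂ] (Fin m → ℂ) :=
    χ ModularGroup.S • LinearMap.toContinuousLinearMap (ρ ModularGroup.S).1.mulVecLin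
  have hM : ∀ v, M v = χ ModularGroup.S • (ρ ModularGroup.S).1.mulVec v := fun _ => rfl
  have hcompact : ∀ φ ∈ Sc, IsCompactIntegrable φ := fun φ hφ =>
    (hSc.isTestFunction φ hφ).isCompactIntegrable
  have haxis (y : ℝ) (hy : 0 < y) := hSc.inversion_on_imaginary_axis k χ (ρ ModularGroup.S).1 1
    (h.continuousOn_mul_I k) (fun φ hφ => by
      rw [one_mul, ← h.Lf_eq_integral k (hcompact φ hφ),
        ← h.Lf_eq_integral k ((hcompact φ hφ).testSlash k χ), hL φ hφ]) hy
  have hdelta (y : ℝ) (hy : 0 < y) := hSc.inversion_on_imaginary_axis k χ (ρ ModularGroup.S).1 (-1)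
    (h.continuousOn_delta_mul_I k) (fun φ hφ => by
      rw [neg_one_mul, ← h.Ldeltaf_eq_integral k (hcompact φ hφ),
        ← h.Ldeltaf_eq_integral k ((hcompact φ hφ).testSlash k χ), hLdelta φ hφ]) hy
  simp only [one_mul, neg_one_mul, ← hM] at haxis hdelta
  have hτ : ((ModularGroup.S • τ : ℍ) : ℂ) = -(τ : ℂ)⁻¹ := by
    rw [UpperHalfPlane.modular_S_smul]
    exact inv_neg
  have hfactor : autFactor k ModularGroup.S τ = (τ : ℂ) ^ (k : ℂ) := by
    simp [autFactor, ModularGroup.S]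
  rw [maassSeries_eq, maassSeries_eq, hτ, hfactor,
    (h.hasShadow k).inversion_formula haxis hdelta τ.im_pos, hM, smul_smul,
    mul_comm]

lemma SubexpCoeffs.summable_holTerm (h : SubexpCoeffs κ n₀ cp cm) (τ : ℍ) (j : Fin m) :
    Summable fun n : {n : ℤ // -(n₀ : ℤ) ≤ n} => holTerm (κ j) (cp j) τ n := by
  simp_rw [holTerm_eq]
  exact summable_holSeries (freqSummable_holFreq n₀ (κ j)) (h.hol j) τ.im_pos

lemma SubexpCoeffs.summable_nonholTerm (h : SubexpCoeffs κ n₀ cp cm) (k : ℝ) (τ : ℍ)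
    (j : Fin m) :
    Summable fun n : {n : ℤ // (n : ℝ) + κ j < 0} => nonholTerm k (κ j) (cm j) τ n := by
  simp_rw [nonholTerm_eq]
  exact summable_nonholSeries k (freqSummable_nonholFreq (κ j)) (nonholFreq_pos (κ j))
    (h.nonhol j) τ.im_pos

lemma SubexpCoeffs.laplacian_eq_zero (h : SubexpCoeffs κ n₀ cp cm) (k : ℝ) {z : ℂ}
    (hz : 0 < z.im) :
    laplacian k (fun z => maassSeries k κ n₀ cp cm (UpperHalfPlane.ofComplex z)) z = 0 :=
  ((h.hasShadow k).congr fun _ hw =>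
    (maassSeries_ofComplex_eventuallyEq k κ n₀ cp cm hw).eq_of_nhds).laplacian_eq_zero hz

end Modularity

end VVMaass

end

theorem mainTheorem2_general {m : ℕ} (k : ℝ)
    (χ : Matrix.SpecialLinearGroup (Fin 2) ℤ → ℂ) (hχ : VVMaass.IsMultiplierSystem k χ)
    (ρ : Matrix.SpecialLinearGroup (Fin 2) ℤ →* Matrix.unitaryGroup (Fin m) ℂ)
    (κ : Fin m → ℝ)
    (hT : ∀ j, χ ModularGroup.T • Matrix.mulVec (ρ ModularGroup.T).1 (Pi.single j 1) =
      Complex.exp (2 * Real.pi * Complex.I * (κ j : ℂ)) • (Pi.single j 1 : Fin m → ℂ))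
    (n₀ : ℕ) (cp cm : Fin m → ℤ → ℂ)
    (hgrowth : ∀ ε : ℝ, 0 < ε → ∀ j,
      (cp j =O[Filter.atTop] fun n : ℤ => Real.exp (ε * |(n : ℝ)|)) ∧
      (cm j =O[Filter.atBot] fun n : ℤ => Real.exp (ε * |(n : ℝ)|)))
    (Sc : Set (ℝ → ℂ)) (hSc : VVMaass.IsTestSpace Sc)
    (hL : ∀ φ ∈ Sc,
      VVMaass.Lf k κ n₀ cp cm φ =
        Complex.I ^ (k : ℂ) • Matrix.mulVec (ρ ModularGroup.S).1
          (VVMaass.Lf k κ n₀ cp cm (VVMaass.testSlash k χ φ)))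
    (hLdelta : ∀ φ ∈ Sc,
      VVMaass.Ldeltaf k κ n₀ cp cm φ =
        (-Complex.I ^ (k : ℂ)) • Matrix.mulVec (ρ ModularGroup.S).1
          (VVMaass.Ldeltaf k κ n₀ cp cm (VVMaass.testSlash k χ φ))) :
    VVMaass.IsHarmonicWeakMaassForm k χ ρ κ (VVMaass.maassSeries k κ n₀ cp cm) := by
  have h := VVMaass.subexpCoeffs_of_isBigO κ n₀ hgrowth
  have hS := h.transforms_S hSc hL hLdelta
  have hT' := VVMaass.transforms_T k n₀ cp cm hT
  exact
    { realAnalytic := fun z hz => (h.analyticAt k hz).congr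
        (VVMaass.maassSeries_ofComplex_eventuallyEq k κ n₀ cp cm hz).symm
      slash_eq := fun γ => (VVMaass.transforms_of_generators hχ hS hT' γ).slash_eq hχ
      harmonic := fun z hz => h.laplacian_eq_zero k hz
      fourier := ⟨n₀, cp, cm, fun τ => ⟨h.summable_holTerm τ, h.summable_nonholTerm k τ, rfl⟩⟩ }

theorem mainTheorem2 {m : ℕ} (k : ℝ) (hk : ∃ N : ℤ, k = (N : ℝ) / 2)
    (χ : Matrix.SpecialLinearGroup (Fin 2) ℤ → ℂ) (hχ : VVMaass.IsMultiplierSystem k χ)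
    (ρ : Matrix.SpecialLinearGroup (Fin 2) ℤ →* Matrix.unitaryGroup (Fin m) ℂ)
    (κ : Fin m → ℝ) (hκ : ∀ j, 0 ≤ κ j ∧ κ j < 1)
    (hT : ∀ j, χ ModularGroup.T • Matrix.mulVec (ρ ModularGroup.T).1 (Pi.single j 1) =
      Complex.exp (2 * Real.pi * Complex.I * (κ j : ℂ)) • (Pi.single j 1 : Fin m → ℂ))
    (n₀ : ℕ) (cp cm : Fin m → ℤ → ℂ)
    (hgrowth : ∃ C : ℝ, 0 < C ∧ ∀ j,
      (cp j =O[Filter.atTop] fun n : ℤ => Real.exp (C * Real.sqrt |(n : ℝ)|)) ∧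
      (cm j =O[Filter.atBot] fun n : ℤ => Real.exp (C * Real.sqrt |(n : ℝ)|)))
    (Sc : Set (ℝ → ℂ)) (hSc : VVMaass.IsTestSpace Sc)
    (hL : ∀ φ ∈ Sc,
      VVMaass.Lf k κ n₀ cp cm φ =
        Complex.I ^ (k : ℂ) • Matrix.mulVec (ρ ModularGroup.S).1
          (VVMaass.Lf k κ n₀ cp cm (VVMaass.testSlash k χ φ)))
    (hLdelta : ∀ φ ∈ Sc,
      VVMaass.Ldeltaf k κ n₀ cp cm φ =
        (-Complex.I ^ (k : ℂ)) • Matrix.mulVec (ρ ModularGroup.S).1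
          (VVMaass.Ldeltaf k κ n₀ cp cm (VVMaass.testSlash k χ φ))) :
    VVMaass.IsHarmonicWeakMaassForm k χ ρ κ (VVMaass.maassSeries k κ n₀ cp cm) := by
  obtain ⟨C, -, hC⟩ := hgrowth
  exact mainTheorem2_general k χ hχ ρ κ hT n₀ cp cm (fun ε hε j =>
    ⟨(hC j).1.trans (VVMaass.isBigO_exp_mul_sqrt_exp_mul C hε _),
      (hC j).2.trans (VVMaass.isBigO_exp_mul_sqrt_exp_mul C hε _)⟩) Sc hSc hL hLdelta
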